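/- Let $X$ be a real-valued random variable on a probability space $(\Omega,\mathcal F,\mathsf P)$. For $\alpha\in(0,\infty)$ let $\mathcal X_\alpha$ be the set of all real-valued random variables $X$ on this space with $\mathsf E X_+^\alpha<\infty$, and let $\mathcal X_\infty$ be the set of those $X$ with $\mathsf E e^{\lambda X}<\infty$ for some real $\lambda>0$; here $u_+=\max(u,0)$. Put $\|Z\|_\gamma=(\mathsf E|Z|^\gamma)^{1/\gamma}$ for $\gamma\in(0,\infty)$, $$x_*=\sup\operatorname{supp}X,\quad p_*=\mathsf P(X=x_*),\quad x_{**}=\sup\big((\operatorname{supp}X)\setminus\{x_*\}\big)\in[-\infty,\infty]$$ (with $\sup\emptyset=-\infty$, and $p_*=0$ if $x_*=\infty$), and, for $p\in(0,1)$ and $t\in\mathbb R$, $$P_0(X;t)=\mathsf P(X\ge t),\quad Q_0(X;p)=\inf\{x\in\mathbb R:\mathsf P(X\ge x)<p\},\quad B_\alpha(X;p)(t)=t+\frac{\|(X-t)_+\|_\alpha}{p^{1/\alpha}}.$$ For $\alpha\in[1,\infty)$, $X\in\mathcal X_\alpha$ and $p\in(0,1)$ the set of all minimizers $t\in\mathbb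 R$ of $B_\alpha(X;p)(t)$ has a largest element, denoted by ${}_{\alpha-1}Q(X;p)$. **Proposition.** Let $\alpha\in[1,\infty)$, $p\in(0,1)$ and $X\in\mathcal X_\alpha$, unless indicated otherwise. Then the following statements are true. (i) *Computation.* (a) If $p\le p_*$, then ${}_{\alpha-1}Q(X;p)=x_*=Q_0(X;p)$. (b) Suppose that $\alpha>1$. For real $t<x_*$ let $${}_{\alpha-1}P(X;t)=\Big(\frac{\|(X-t)_+\|_{\alpha-1}}{\|(X-t)_+\|_\alpha}\Big)^{(\alpha-1)\alpha}.$$ Then, for all real $t<x_*$, $${}_{\alpha-1}P(X;t)=\frac{\big(\mathsf E(X-t)_+^{\alpha-1}\big)^{\alpha}}{\big(\mathsf E(X-t)_+^{\alpha}\big)^{\alpha-1}}=\mathsf P(X>t)\,\frac{\big(\mathsf E((X-t)^{\alpha-1}\mid X>t)\big)^{\alpha}}{\big(\mathsf E((X-t)^{\alpha}\mid X>t)\big)^{\alpha-1}}.$$ If $p\in(p_*,1)$, then the equation ${}_{\alpha-1}P(X;t)=p$ has exactly one root $t\in(-\infty,x_*)$, this root is ${}_{\alpha-1}Q(X;p)$,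 and ${}_{\alpha-1}Q(X;p)<x_{**}$. Furthermore, for all real $t<x_*$ one has ${}_{\alpha-1}P(X;t)\le\mathsf P(X>t)\le P_0(X;t)$, and ${}_{a-1}P(X;t)\to\mathsf P(X>t)$ as $a\downarrow1$ (given that $X\in\mathcal X_\alpha$ for some $\alpha>1$); in addition, ${}_{\alpha-1}P(X;t)<\mathsf P(X>t)$ for all real $t<x_{**}$. (ii) *Dependence on $p$.* ${}_{\alpha-1}Q(X;p)$ is nonincreasing in $p\in(0,1)$ and equals the constant $x_*$ for $p\in(0,p_*]\cap(0,1)$. If $\alpha>1$, then ${}_{\alpha-1}Q(X;p)$ is strictly decreasing in $p\in[p_*,1)\cap(0,1)$ and continuous in $p\in(p_*,1)$; if moreover $p_*<1$, then ${}_{\alpha-1}Q(X;p)\to x_{**}$ as $p\downarrow p_*$, and ${}_{\alpha-1}Q(X;p)\to-\infty$ as $p\uparrow1$. (iii) *Dependence on $\alpha$.* If $1\le\alpha<\beta<\infty$ and $X\in\mathcal X_\beta$, then ${}_{\beta-1}Q(X;p)\le{}_{\alpha-1}Q(X;p)$, and the inequality is strict if $p\in(p_*,1)$. For all $X\in\mathcal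 X_\alpha$, ${}_{\alpha-1}Q(X;p)\le{}_0Q(X;p)=Q_0(X;p)$. If $p\in(p_*,1)$ and $X\in\mathcal X_\infty$, then ${}_{\alpha-1}Q(X;p)\to-\infty$ as $\alpha\uparrow\infty$. (iv) *Consistency.* ${}_{\alpha-1}Q(c;p)=c$ for all $c\in\mathbb R$. (v) *Positive homogeneity.* ${}_{\alpha-1}Q(\kappa X;p)=\kappa\,{}_{\alpha-1}Q(X;p)$ for all $\kappa\in[0,\infty)$. (vi) *Translation invariance.* ${}_{\alpha-1}Q(X+c;p)={}_{\alpha-1}Q(X;p)+c$ for all $c\in\mathbb R$. (vii) *Partial monotonicity.* If $c\in\mathbb R$ and $X\le c$ almost surely, then ${}_{\alpha-1}Q(X;p)\le{}_{\alpha-1}Q(c;p)$; also, ${}_{\alpha-1}Q(X;p)\le{}_{\alpha-1}Q(X+c;p)$ for any $c\in[0,\infty)$. Suppose for (viii) and (ix) that the probability space carries a random variable uniformly distributed on $[0,1]$. (viii) For any $\alpha\in(1,\infty)$ and any $p\in(0,1)$, the map $X\mapsto{}_{\alpha-1}Q(X;p)$ is neither nondecreasing nor nonincreasing on $\mathcal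 X_\alpha$ with respect to the pointwise order. (ix) For any $\alpha\in[1,\infty)$ and any $p\in(0,1)$, the map $X\mapsto{}_{\alpha-1}Q(X;p)$ is not subadditive on $\mathcal X_\alpha$, and it is not convex on $\mathcal X_\alpha$. -/

import Mathlib

open MeasureTheory Filter Topology Set

/-- The set `𝒳_α`, for `α ∈ (0,∞)`, of all real-valued random variables `X` on the probability
space `(Ω, P)` such that `E X_+^α < ∞`. -/
def RVPow {Ω : Type*} [MeasurableSpace Ω] (P : Measure Ω) (α : ℝ) : Set (Ω → ℝ) :=
  {X | Measurable X ∧ Integrable (fun ω => (max (X ω) 0) ^ α) P}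

/-- The set `𝒳_∞` of all real-valued random variables `X` on `(Ω, P)` such that
`E e^{λX} < ∞` for some real `λ > 0`. -/
def RVExp {Ω : Type*} [MeasurableSpace Ω] (P : Measure Ω) : Set (Ω → ℝ) :=
  {X | Measurable X ∧ ∃ l : ℝ, 0 < l ∧ Integrable (fun ω => Real.exp (l * X ω)) P}

/-- `x_* = sup supp X`, an extended real number. -/
noncomputable def xStar {Ω : Type*} [MeasurableSpace Ω] (P : Measure Ω) (X : Ω → ℝ) : EReal :=
  sSup ((fun x : ℝ => (x : EReal)) '' (P.map X).support)

/-- `p_* = P(X = x_*)`, which is `0` if `x_* = ∞`. -/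
noncomputable def pStar {Ω : Type*} [MeasurableSpace Ω] (P : Measure Ω) (X : Ω → ℝ) : ℝ :=
  P.real {ω | (X ω : EReal) = xStar P X}

/-- `x_** = sup ((supp X) \ {x_*})`, an extended real number (`-∞` for the empty set). -/
noncomputable def xStarStar {Ω : Type*} [MeasurableSpace Ω] (P : Measure Ω) (X : Ω → ℝ) : EReal :=
  sSup (((fun x : ℝ => (x : EReal)) '' (P.map X).support) \ {xStar P X})

/-- The tail probability `P_0(X;x) = P(X ≥ x)`. -/
noncomputable def tailProb {Ω : Type*} [MeasurableSpace Ω] (P : Measure Ω) (X : Ω → ℝ)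
    (x : ℝ) : ℝ :=
  P.real {ω | x ≤ X ω}

/-- `Q_0(X;p) = Q(X;p) = inf {x ∈ ℝ : P(X ≥ x) < p}`, the largest `(1-p)`-quantile of `X`
(the value-at-risk). -/
noncomputable def quantileZero {Ω : Type*} [MeasurableSpace Ω] (P : Measure Ω) (X : Ω → ℝ)
    (p : ℝ) : ℝ :=
  sInf {x : ℝ | tailProb P X x < p}

/-- `‖Z‖_γ = (E |Z|^γ)^{1/γ}` for `γ ∈ (0,∞)` (a norm only if `γ ≥ 1`). -/
noncomputable def gNorm {Ω : Type*} [MeasurableSpace Ω] (P : Measure Ω) (γ : ℝ) (Z : Ω → ℝ) : ℝ :=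
  (∫ ω, |Z ω| ^ γ ∂P) ^ (1 / γ)

/-- `B_α(X;p)(t) = t + ‖(X-t)_+‖_α / p^{1/α}` for `α ∈ (0,∞)`. -/
noncomputable def Bfun {Ω : Type*} [MeasurableSpace Ω] (P : Measure Ω) (α : ℝ) (X : Ω → ℝ)
    (p t : ℝ) : ℝ :=
  t + gNorm P α (fun ω => max (X ω - t) 0) / p ^ (1 / α)

/-- The set of all minimizers `t ∈ ℝ` of `B_α(X;p)(t)`. -/
def argminB {Ω : Type*} [MeasurableSpace Ω] (P : Measure Ω) (α : ℝ) (X : Ω → ℝ) (p : ℝ) : Set ℝ :=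
  {t | ∀ s : ℝ, Bfun P α X p t ≤ Bfun P α X p s}

/-- `_{α-1}Q(X;p)`, the largest minimizer of `B_α(X;p)(·)`. -/
noncomputable def lowerQ {Ω : Type*} [MeasurableSpace Ω] (P : Measure Ω) (α : ℝ) (X : Ω → ℝ)
    (p : ℝ) : ℝ :=
  sSup (argminB P α X p)

/-- `_{α-1}P(X;t) = (‖(X-t)_+‖_{α-1} / ‖(X-t)_+‖_α)^{(α-1)α}` for `α ∈ (1,∞)`, `t < x_*`. -/
noncomputable def lowerP {Ω : Type*} [MeasurableSpace Ω] (P : Measure Ω) (α : ℝ) (X : Ω → ℝ)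
    (t : ℝ) : ℝ :=
  (gNorm P (α - 1) (fun ω => max (X ω - t) 0) / gNorm P α (fun ω => max (X ω - t) 0))
    ^ ((α - 1) * α)

/-- The probability space `(Ω, P)` carries a random variable that is uniformly distributed
on `[0,1]`. -/
def CarriesUniform {Ω : Type*} [MeasurableSpace Ω] (P : Measure Ω) : Prop :=
  ∃ U : Ω → ℝ, Measurable U ∧ P.map U = volume.restrict (Icc (0 : ℝ) 1)

/-! Write N(t) = ‖(X-t)_+‖_α, so that B(t) = t + N(t)/p^{1/α}. For α > 1 everything rests on one
supporting-line inequality, obtained from Hölder without differentiating: at t < x_* the convex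
function N has subgradient -P(t)^{1/α}, where P(t) is `lowerP` (`posNorm_tangent`). Hence a root of
P(t) = p minimizes B. Equality in Hölder would force X to be constant above a level s < x_**, so P
strictly decreases there (`lowerP_lt_lowerP`). A root exists by the intermediate value theorem, is
unique, and is the largest minimizer; dependence on p is then read off from the equivalences
`lt_lowerQ_iff` and `lowerQ_lt_iff`. For α = 1 the subgradient is -P(X ≥ t), which gives the
quantile (`lowerQ_one`). For p ≤ p_* a Markov-type bound shows that B is minimal at x_*.

Dependence on α: let m(r) = log E[(X-t)^r; X > t]. Then log P(t) = α m(α-1) - (α-1) m(α) is the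
value at 0 of the chord of m over [α-1, α]. For t < x_**, m is strictly convex, so this value
strictly decreases in α; at α = 1 it equals m(0) = log P(X > t) (`StrictConvexOn.intercept_lt`).

As α → ∞, B(-α/λ) is bounded by a quantity tending to λ⁻¹ log(E e^{λX}/p), which is below x_* for a
suitable λ. Points t that stay above a fixed level cannot have so small a value of B
(`tendsto_lowerQ_atBot`).

The negative results use indicators: an event of probability p/2 gives a value at most 0, negative
if α > 1, while the union of two disjoint such events gives 1. -/

set_option linter.unusedSectionVars false

/-! ### Hölder's inequality with its equality case -/

section Holder

variable {Ω : Type*} [MeasurableSpace Ω] {μ : Measure Ω} {F G : Ω → ℝ} {θ : ℝ}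

theorem rpow_mul_rpow_lt_of_ne {a b : ℝ} (ha : 0 ≤ a) (hb : 0 ≤ b) (h0 : 0 < θ) (h1 : θ < 1)
    (hab : a ≠ b) : a ^ θ * b ^ (1 - θ) < θ * a + (1 - θ) * b := by
  have h := (Real.geom_mean_lt_arith_mean_weighted_iff_of_pos (Finset.univ : Finset (Fin 2))
    ![θ, 1 - θ] ![a, b] (by intro i _; fin_cases i <;> simp [h0, h1])
    (by simp) (by intro i _; fin_cases i <;> simp [ha, hb])).2
    ⟨0, by simp, 1, by simp, by simpa using hab⟩
  simpa using h

theorem rpow_mul_rpow_le {a b : ℝ} (ha : 0 ≤ a) (hb : 0 ≤ b) (h0 : 0 < θ) (h1 : θ < 1) :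
    a ^ θ * b ^ (1 - θ) ≤ θ * a + (1 - θ) * b :=
  Real.geom_mean_le_arith_mean2_weighted h0.le (by linarith) ha hb (by ring)

theorem integrable_rpow_mul_rpow (hF : Integrable F μ) (hG : Integrable G μ)
    (hF0 : ∀ ω, 0 ≤ F ω) (hG0 : ∀ ω, 0 ≤ G ω) (h0 : 0 < θ) (h1 : θ < 1) :
    Integrable (fun ω => F ω ^ θ * G ω ^ (1 - θ)) μ := by
  refine ((hF.const_mul θ).add (hG.const_mul (1 - θ))).mono' ?_ (ae_of_all _ fun ω => ?_)
  · exact ((hF.aemeasurable.pow_const θ).mul (hG.aemeasurable.pow_const _)).aestronglyMeasurable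
  · rw [Real.norm_of_nonneg
      (mul_nonneg (Real.rpow_nonneg (hF0 ω) _) (Real.rpow_nonneg (hG0 ω) _))]
    exact rpow_mul_rpow_le (hF0 ω) (hG0 ω) h0 h1

theorem integral_rpow_mul_rpow_div (hF0 : ∀ ω, 0 ≤ F ω) (hG0 : ∀ ω, 0 ≤ G ω)
    (a b : ℝ) (ha : 0 < a) (hb : 0 < b) :
    ∫ ω, (F ω / a) ^ θ * (G ω / b) ^ (1 - θ) ∂μ
      = (∫ ω, F ω ^ θ * G ω ^ (1 - θ) ∂μ) / (a ^ θ * b ^ (1 - θ)) := by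
  rw [← integral_div]
  congr 1 with ω
  rw [Real.div_rpow (hF0 ω) ha.le, Real.div_rpow (hG0 ω) hb.le]
  field_simp

/-- Normalize both integrals to 1 and integrate the weighted AM-GM inequality. If one integral
vanishes, so does the product almost everywhere. -/
theorem integral_rpow_mul_rpow_le (hF : Integrable F μ) (hG : Integrable G μ)
    (hF0 : ∀ ω, 0 ≤ F ω) (hG0 : ∀ ω, 0 ≤ G ω) (h0 : 0 < θ) (h1 : θ < 1) :
    ∫ ω, F ω ^ θ * G ω ^ (1 - θ) ∂μ ≤ (∫ ω, F ω ∂μ) ^ θ * (∫ ω, G ω ∂μ) ^ (1 - θ) := by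
  rcases (integral_nonneg (f := F) (μ := μ) hF0).eq_or_lt with ha | ha
  · have hz := (integral_eq_zero_iff_of_nonneg hF0 hF).1 ha.symm
    have : ∫ ω, F ω ^ θ * G ω ^ (1 - θ) ∂μ = 0 := by
      refine integral_eq_zero_of_ae ?_
      filter_upwards [hz] with ω h
      simp [show F ω = 0 from h, Real.zero_rpow h0.ne']
    rw [this]
    exact mul_nonneg (Real.rpow_nonneg (integral_nonneg (f := F) (μ := μ) hF0) _)
      (Real.rpow_nonneg (integral_nonneg (f := G) (μ := μ) hG0) _)
  rcases (integral_nonneg (f := G) (μ := μ) hG0).eq_or_lt with hb | hb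
  · have hz := (integral_eq_zero_iff_of_nonneg hG0 hG).1 hb.symm
    have : ∫ ω, F ω ^ θ * G ω ^ (1 - θ) ∂μ = 0 := by
      refine integral_eq_zero_of_ae ?_
      filter_upwards [hz] with ω h
      simp [show G ω = 0 from h, Real.zero_rpow (sub_pos.2 h1).ne']
    rw [this]
    exact mul_nonneg (Real.rpow_nonneg (integral_nonneg (f := F) (μ := μ) hF0) _)
      (Real.rpow_nonneg (integral_nonneg (f := G) (μ := μ) hG0) _)
  set a := ∫ ω, F ω ∂μ with hadef
  set b := ∫ ω, G ω ∂μ with hbdef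
  have hF0' : ∀ ω, 0 ≤ F ω / a := fun ω => div_nonneg (hF0 ω) ha.le
  have hG0' : ∀ ω, 0 ≤ G ω / b := fun ω => div_nonneg (hG0 ω) hb.le
  have key : ∫ ω, (F ω / a) ^ θ * (G ω / b) ^ (1 - θ) ∂μ
      ≤ ∫ ω, θ * (F ω / a) + (1 - θ) * (G ω / b) ∂μ :=
    integral_mono
      (integrable_rpow_mul_rpow (hF.div_const a) (hG.div_const b) hF0' hG0' h0 h1)
      (((hF.div_const a).const_mul θ).add ((hG.div_const b).const_mul (1 - θ)))
      fun ω => rpow_mul_rpow_le (hF0' ω) (hG0' ω) h0 h1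
  rw [integral_rpow_mul_rpow_div hF0 hG0 a b ha hb,
    integral_add ((hF.div_const a).const_mul θ) ((hG.div_const b).const_mul (1 - θ)),
    integral_const_mul, integral_const_mul, integral_div, integral_div, ← hadef, ← hbdef,
    div_self ha.ne', div_self hb.ne', div_le_iff₀ (by positivity)] at key
  linarith

/-- With equality, the nonnegative AM-GM gap of the normalized functions integrates to 0, so they
agree almost everywhere. -/
theorem integral_rpow_mul_rpow_lt (hF : Integrable F μ) (hG : Integrable G μ)
    (hF0 : ∀ ω, 0 ≤ F ω) (hG0 : ∀ ω, 0 ≤ G ω) (h0 : 0 < θ) (h1 : θ < 1)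
    (ha : 0 < ∫ ω, F ω ∂μ) (hb : 0 < ∫ ω, G ω ∂μ)
    (hne : ¬ ∀ᵐ ω ∂μ, F ω / ∫ ω, F ω ∂μ = G ω / ∫ ω, G ω ∂μ) :
    ∫ ω, F ω ^ θ * G ω ^ (1 - θ) ∂μ < (∫ ω, F ω ∂μ) ^ θ * (∫ ω, G ω ∂μ) ^ (1 - θ) := by
  refine lt_of_le_of_ne (integral_rpow_mul_rpow_le hF hG hF0 hG0 h0 h1) fun heq => hne ?_
  set a := ∫ ω, F ω ∂μ with hadef
  set b := ∫ ω, G ω ∂μ with hbdef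
  have hF0' : ∀ ω, 0 ≤ F ω / a := fun ω => div_nonneg (hF0 ω) ha.le
  have hG0' : ∀ ω, 0 ≤ G ω / b := fun ω => div_nonneg (hG0 ω) hb.le
  have i1 := integrable_rpow_mul_rpow (hF.div_const a) (hG.div_const b) hF0' hG0' h0 h1
  have i2 : Integrable (fun ω => θ * (F ω / a) + (1 - θ) * (G ω / b)) μ :=
    ((hF.div_const a).const_mul θ).add ((hG.div_const b).const_mul (1 - θ))
  have hz : ∫ ω, (θ * (F ω / a) + (1 - θ) * (G ω / b))
      - (F ω / a) ^ θ * (G ω / b) ^ (1 - θ) ∂μ = 0 := by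
    rw [integral_sub i2 i1, integral_rpow_mul_rpow_div hF0 hG0 a b ha hb, heq,
      integral_add ((hF.div_const a).const_mul θ) ((hG.div_const b).const_mul (1 - θ)),
      integral_const_mul, integral_const_mul, integral_div, integral_div, ← hadef, ← hbdef,
      div_self ha.ne', div_self hb.ne', div_self (by positivity)]
    ring
  have hz' := (integral_eq_zero_iff_of_nonneg
    (fun ω => sub_nonneg.2 (rpow_mul_rpow_le (hF0' ω) (hG0' ω) h0 h1)) (i2.sub i1)).1 hz
  filter_upwards [hz'] with ω h
  by_contra hne
  have := rpow_mul_rpow_lt_of_ne (hF0' ω) (hG0' ω) h0 h1 hne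
  simp only [Pi.zero_apply] at h
  linarith

end Holder

/-! ### Essential supremum, its atom, and tail probabilities -/

section Support

variable {Ω : Type*} [MeasurableSpace Ω] {P : Measure Ω} {X : Ω → ℝ}

theorem ae_mem_support (hX : Measurable X) : ∀ᵐ ω ∂P, X ω ∈ (P.map X).support :=
  ae_of_ae_map hX.aemeasurable Measure.support_mem_ae

theorem measure_pos_of_mem_support (hX : Measurable X) {x : ℝ} (hx : x ∈ (P.map X).support)
    {U : Set ℝ} (hU : IsOpen U) (hxU : x ∈ U) : 0 < P (X ⁻¹' U) := by
  rw [← Measure.map_apply hX hU.measurableSet]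
  exact (Measure.mem_support_iff_forall x).1 hx U (hU.mem_nhds hxU)

theorem xStarStar_le_xStar : xStarStar P X ≤ xStar P X := sSup_le_sSup sdiff_subset

theorem pStar_nonneg : 0 ≤ pStar P X := measureReal_nonneg

theorem exists_xStar_eq_coe_of_pStar_pos (h : 0 < pStar P X) :
    ∃ x : ℝ, xStar P X = x ∧ pStar P X = P.real {ω | X ω = x} := by
  have : {ω | (X ω : EReal) = xStar P X}.Nonempty := by
    by_contra hne
    rw [not_nonempty_iff_eq_empty] at hne
    simp [pStar, hne] at h
  obtain ⟨ω, hω⟩ := this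
  refine ⟨X ω, Eq.symm hω, ?_⟩
  rw [pStar, show xStar P X = X ω from Eq.symm hω]
  simp only [EReal.coe_eq_coe_iff]

theorem ae_le_xStar (hX : Measurable X) : ∀ᵐ ω ∂P, (X ω : EReal) ≤ xStar P X := by
  filter_upwards [ae_mem_support hX] with ω h
  exact le_sSup ⟨_, h, rfl⟩

/-- Above a level `t < x_**` the random variable is not almost surely constant. -/
theorem not_ae_eq_const_of_lt_xStarStar (hX : Measurable X) {t : ℝ}
    (ht : (t : EReal) < xStarStar P X) (c : ℝ) : ¬ ∀ᵐ ω ∂P, t < X ω → X ω = c := by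
  intro h
  obtain ⟨_, ⟨⟨x, hx, rfl⟩, hne⟩, htx⟩ := lt_sSup_iff.1 ht
  have hlt : (x : EReal) < xStar P X := lt_of_le_of_ne (le_sSup ⟨x, hx, rfl⟩) hne
  obtain ⟨_, ⟨y, hy, rfl⟩, hxy⟩ := lt_sSup_iff.1 hlt
  have htx := EReal.coe_lt_coe_iff.1 htx
  have hxy := EReal.coe_lt_coe_iff.1 hxy
  obtain ⟨z, hxz, hzy⟩ := exists_between hxy
  -- Every charged open set above t must contain c; the disjoint sets (t, z) and (z, ∞) are both
  -- charged.
  have key : ∀ U : Set ℝ, IsOpen U → U ⊆ Ioi t → ∀ u ∈ U, u ∈ (P.map X).support → c ∈ U := by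
    intro U hU hUt u hu hus
    by_contra hc
    refine (measure_pos_of_mem_support hX hus hU hu).ne' ?_
    rw [← compl_compl (X ⁻¹' U), ← mem_ae_iff]
    filter_upwards [h] with ω hω hmem
    exact hc (hω (hUt hmem) ▸ hmem)
  have h1 := key (Ioo t z) isOpen_Ioo (fun _ h => h.1) x ⟨htx, hxz⟩ hx
  have h2 := key (Ioi z) isOpen_Ioi (fun u hu => (htx.trans hxz).trans hu) y hzy hy
  exact lt_asymm h1.2 h2

/-- Almost surely X lies in its support, which has no point other than x_* above x_**. -/
theorem real_gt_eq_pStar (hX : Measurable X) {t : ℝ} (h1 : xStarStar P X ≤ t)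
    (h2 : (t : EReal) < xStar P X) : P.real {ω | t < X ω} = pStar P X := by
  refine measureReal_congr ?_
  filter_upwards [ae_mem_support hX] with ω hω
  refine propext ⟨fun h => ?_, fun h => ?_⟩
  · by_contra hne
    exact (EReal.coe_lt_coe_iff.2 h).not_ge ((le_sSup ⟨⟨_, hω, rfl⟩, hne⟩ :
      (X ω : EReal) ≤ xStarStar P X).trans h1)
  · exact EReal.coe_lt_coe_iff.1 (h2.trans_eq (Eq.symm h))

variable [IsProbabilityMeasure P]

theorem support_map_nonempty (hX : Measurable X) : (P.map X).support.Nonempty := by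
  have := Measure.isProbabilityMeasure_map (μ := P) hX.aemeasurable
  exact Measure.nonempty_support (IsProbabilityMeasure.ne_zero _)

theorem bot_lt_xStar (hX : Measurable X) : ⊥ < xStar P X := by
  obtain ⟨x, hx⟩ := support_map_nonempty (P := P) hX
  exact (EReal.bot_lt_coe x).trans_le (le_sSup ⟨x, hx, rfl⟩)

theorem real_pos_of_lt_xStar (hX : Measurable X) {t : ℝ} (ht : (t : EReal) < xStar P X) :
    0 < P.real {ω | t < X ω} := by
  obtain ⟨_, ⟨x, hx, rfl⟩, htx⟩ := lt_sSup_iff.1 ht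
  exact ENNReal.toReal_pos
    (measure_pos_of_mem_support hX hx isOpen_Ioi (EReal.coe_lt_coe_iff.1 htx)).ne'
    (measure_ne_top _ _)

theorem exists_xStar_eq_coe (hX : Measurable X) (h : xStar P X ≠ ⊤) :
    ∃ x : ℝ, xStar P X = x :=
  ⟨_, (EReal.coe_toReal h (bot_lt_xStar hX).ne').symm⟩

theorem xStar_eq_of_ae_le (hX : Measurable X) {c : ℝ} (h : ∀ᵐ ω ∂P, X ω ≤ c)
    (hc : 0 < P.real {ω | X ω = c}) :
    xStar P X = c ∧ pStar P X = P.real {ω | X ω = c} := by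
  have hx : xStar P X = c := by
    refine le_antisymm ?_ ?_
    · by_contra! hlt
      have := real_pos_of_lt_xStar hX hlt
      rw [Measure.real, ENNReal.toReal_pos_iff] at this
      refine this.1.ne' ?_
      rw [← compl_compl {ω | c < X ω}, ← mem_ae_iff]
      filter_upwards [h] with ω hω
      simpa using hω
    · by_contra! hlt
      refine hc.ne' ?_
      rw [measureReal_eq_zero_iff, ← compl_compl {ω | X ω = c}, ← mem_ae_iff]
      filter_upwards [ae_le_xStar hX] with ω hω heq
      rw [show X ω = c from heq] at hω
      exact hω.not_gt hlt
  refine ⟨hx, ?_⟩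
  rw [pStar, hx]
  simp only [EReal.coe_eq_coe_iff]

theorem ae_le_of_xStar_le (hX : Measurable X) {c : ℝ} (h : xStar P X ≤ c) :
    ∀ᵐ ω ∂P, X ω ≤ c := by
  filter_upwards [ae_le_xStar hX] with ω hω
  exact EReal.coe_le_coe_iff.1 (hω.trans h)

/-- If `p > p_*`, the upper tail probability is below `p` at some level `t < x_*`. -/
theorem exists_real_gt_lt (hX : Measurable X) {p : ℝ} (hp : pStar P X < p) :
    ∃ t : ℝ, (t : EReal) < xStar P X ∧ P.real {ω | t < X ω} < p := by
  -- Approximating in `EReal` treats finite and infinite x_* together. The events {u_n < X} decrease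
  -- to {X = x_*}, up to a null set.
  obtain ⟨u, hu_mono, hu_lt, hu_lim⟩ := exists_seq_strictMono_tendsto' (bot_lt_xStar (P := P) hX)
  have hcoe : ∀ n, ((u n).toReal : EReal) = u n := fun n =>
    EReal.coe_toReal ((hu_lt n).2.trans_le le_top).ne (hu_lt n).1.ne'
  have hinter : ⋂ n, {ω | (u n).toReal < X ω} =ᵐ[P] {ω | (X ω : EReal) = xStar P X} := by
    filter_upwards [ae_le_xStar hX] with ω hω
    refine propext ⟨fun h => ?_, fun h => ?_⟩
    · refine le_antisymm hω (le_of_tendsto' hu_lim fun n => ?_)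
      rw [← hcoe n]
      exact EReal.coe_le_coe_iff.2 (mem_iInter.1 h n).le
    · refine mem_iInter.2 fun n => EReal.coe_lt_coe_iff.1 ?_
      rw [hcoe n, show (X ω : EReal) = xStar P X from h]
      exact (hu_lt n).2
  have hlim : Tendsto (fun n => P {ω | (u n).toReal < X ω}) atTop
      (𝓝 (P (⋂ n, {ω | (u n).toReal < X ω}))) := by
    refine tendsto_measure_iInter_atTop
      (fun n => (measurableSet_lt measurable_const hX).nullMeasurableSet)
      (fun m n hmn ω hω => ?_) ⟨0, measure_ne_top _ _⟩
    change (u n).toReal < X ω at hω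
    change (u m).toReal < X ω
    refine lt_of_le_of_lt (EReal.coe_le_coe_iff.1 ?_) hω
    rw [hcoe, hcoe]
    exact hu_mono.monotone hmn
  rw [measure_congr hinter] at hlim
  have hlim' := (ENNReal.tendsto_toReal (measure_ne_top _ _)).comp hlim
  obtain ⟨n, hn⟩ := (hlim'.eventually_lt_const hp).exists
  exact ⟨(u n).toReal, (hcoe n).trans_lt (hu_lt n).2, hn⟩

theorem exists_tailProb_gt {X : Ω → ℝ} {p : ℝ} (hp : p < 1) :
    ∃ y : ℝ, p < tailProb P X y := by
  have hun : ⋃ n : ℕ, {ω | -(n : ℝ) ≤ X ω} = univ := by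
    refine eq_univ_of_forall fun ω => mem_iUnion.2 ?_
    obtain ⟨n, hn⟩ := exists_nat_ge (-X ω)
    exact ⟨n, show -(n : ℝ) ≤ X ω by linarith⟩
  have hlim : Tendsto (fun n : ℕ => P {ω | -(n : ℝ) ≤ X ω}) atTop
      (𝓝 (P (⋃ n : ℕ, {ω | -(n : ℝ) ≤ X ω}))) := by
    refine tendsto_measure_iUnion_atTop fun m n hmn ω hω => ?_
    change -(n : ℝ) ≤ X ω
    change -(m : ℝ) ≤ X ω at hω
    have : (m : ℝ) ≤ n := by exact_mod_cast hmn
    linarith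
  rw [hun, measure_univ] at hlim
  have hlim' := (ENNReal.tendsto_toReal ENNReal.one_ne_top).comp hlim
  obtain ⟨n, hn⟩ := (hlim'.eventually_const_lt (by simpa using hp)).exists
  exact ⟨-n, hn⟩

theorem exists_tailProb_lt (hX : Measurable X) {p : ℝ} (hp : 0 < p) :
    ∃ y : ℝ, tailProb P X y < p := by
  have hin : ⋂ n : ℕ, {ω | (n : ℝ) ≤ X ω} = ∅ := by
    refine eq_empty_of_forall_notMem fun ω h => ?_
    obtain ⟨n, hn⟩ := exists_nat_gt (X ω)
    exact absurd (mem_iInter.1 h n) (not_le.2 hn)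
  have hlim : Tendsto (fun n : ℕ => P {ω | (n : ℝ) ≤ X ω}) atTop
      (𝓝 (P (⋂ n : ℕ, {ω | (n : ℝ) ≤ X ω}))) := by
    refine tendsto_measure_iInter_atTop
      (fun n => (measurableSet_le measurable_const hX).nullMeasurableSet)
      (fun m n hmn ω hω => ?_) ⟨0, measure_ne_top _ _⟩
    change (n : ℝ) ≤ X ω at hω
    change (m : ℝ) ≤ X ω
    have : (m : ℝ) ≤ n := by exact_mod_cast hmn
    exact this.trans hω
  rw [hin, measure_empty] at hlim
  have hlim' := (ENNReal.tendsto_toReal ENNReal.zero_ne_top).comp hlim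
  obtain ⟨n, hn⟩ := (hlim'.eventually_lt_const (by simpa using hp)).exists
  exact ⟨n, hn⟩

end Support

/-- `E (X - t)_+^r`. -/
noncomputable def posMoment {Ω : Type*} [MeasurableSpace Ω] (P : Measure Ω) (X : Ω → ℝ)
    (r t : ℝ) : ℝ :=
  ∫ ω, (max (X ω - t) 0) ^ r ∂P

/-- `‖(X - t)_+‖_α`. -/
noncomputable def posNorm {Ω : Type*} [MeasurableSpace Ω] (P : Measure Ω) (X : Ω → ℝ)
    (α t : ℝ) : ℝ :=
  posMoment P X α t ^ (1 / α)

/-! ### Truncated moments, the function B, and the case p ≤ p_* -/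

section Moments

variable {Ω : Type*} [MeasurableSpace Ω] {P : Measure Ω} [IsProbabilityMeasure P] {X : Ω → ℝ}
  {α r s t p : ℝ}

theorem max_rpow_nonneg (x r : ℝ) : 0 ≤ (max x 0) ^ r := Real.rpow_nonneg (le_max_right _ _) _

theorem measurable_max_sub_rpow (hX : Measurable X) (t r : ℝ) :
    Measurable fun ω => (max (X ω - t) 0) ^ r :=
  ((hX.sub_const t).max measurable_const).pow_const r

/-- Domination by y^r ≤ 1 + y^α for y = (X-t)_+, together with y ≤ 2 max(X_+, |t|). -/
theorem integrable_max_sub_rpow (hX : X ∈ RVPow P α) (hr : 0 ≤ r) (hrα : r ≤ α) (t : ℝ) :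
    Integrable (fun ω => (max (X ω - t) 0) ^ r) P := by
  have hα : 0 ≤ α := hr.trans hrα
  have hb : Integrable (fun ω => 1 + 2 ^ α * ((max (X ω) 0) ^ α + |t| ^ α)) P :=
    (integrable_const _).add ((hX.2.add (integrable_const _)).const_mul _)
  refine hb.mono' (measurable_max_sub_rpow hX.1 t r).aestronglyMeasurable (ae_of_all _ fun ω => ?_)
  rw [Real.norm_of_nonneg (max_rpow_nonneg _ _)]
  set y := max (X ω - t) 0 with hy
  have hy0 : 0 ≤ y := le_max_right _ _
  have h1 : y ^ r ≤ 1 + y ^ α := by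
    rcases le_total y 1 with h | h
    · have := Real.rpow_le_one hy0 h hr
      have := Real.rpow_nonneg hy0 α
      linarith
    · have := Real.rpow_le_rpow_of_exponent_le h hrα
      linarith
  have h2 : y ≤ 2 * max (max (X ω) 0) |t| := by
    have h3 := le_max_left (max (X ω) 0) |t|
    have h4 := le_max_right (max (X ω) 0) |t|
    have h5 := le_max_left (X ω) 0
    have h6 := le_max_right (X ω) 0
    have h7 := neg_abs_le t
    refine max_le ?_ ?_ <;> linarith
  have h3 : y ^ α ≤ 2 ^ α * ((max (X ω) 0) ^ α + |t| ^ α) := by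
    refine (Real.rpow_le_rpow hy0 h2 hα).trans ?_
    rw [Real.mul_rpow (by norm_num) (le_max_of_le_right (abs_nonneg t))]
    refine mul_le_mul_of_nonneg_left ?_ (by positivity)
    have h4 := max_rpow_nonneg (X ω) α
    have h5 := Real.rpow_nonneg (abs_nonneg t) α
    rcases max_choice (max (X ω) 0) |t| with h | h <;> rw [h] <;> linarith
  linarith

theorem posMoment_nonneg : 0 ≤ posMoment P X r t :=
  integral_nonneg fun _ => max_rpow_nonneg _ _

theorem posNorm_nonneg : 0 ≤ posNorm P X α t := Real.rpow_nonneg posMoment_nonneg _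

theorem gNorm_max_sub : gNorm P r (fun ω => max (X ω - t) 0) = posNorm P X r t := by
  simp only [gNorm, posNorm, posMoment, abs_of_nonneg (le_max_right (_ : ℝ) (0 : ℝ))]

theorem Bfun_eq : Bfun P α X p t = t + posNorm P X α t / p ^ (1 / α) := by
  rw [Bfun, gNorm_max_sub]

theorem posMoment_pos (hX : X ∈ RVPow P α) (hr : 0 ≤ r) (hrα : r ≤ α)
    (ht : (t : EReal) < xStar P X) : 0 < posMoment P X r t := by
  refine lt_of_le_of_ne posMoment_nonneg fun h => ?_
  have hz := (integral_eq_zero_iff_of_nonneg (fun ω => max_rpow_nonneg (X ω - t) r)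
    (integrable_max_sub_rpow hX hr hrα t)).1 h.symm
  refine (real_pos_of_lt_xStar hX.1 ht).ne' ?_
  rw [measureReal_eq_zero_iff, ← compl_compl {ω | t < X ω}, ← mem_ae_iff]
  filter_upwards [hz] with ω hω hlt
  have : 0 < max (X ω - t) 0 := lt_max_of_lt_left (sub_pos.2 hlt)
  exact (Real.rpow_pos_of_pos this r).ne' hω

theorem posNorm_pos (hX : X ∈ RVPow P α) (hα : 0 ≤ α) (ht : (t : EReal) < xStar P X) :
    0 < posNorm P X α t :=
  Real.rpow_pos_of_pos (posMoment_pos hX hα le_rfl ht) _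

theorem posMoment_eq_zero (hr : r ≠ 0) (h : ∀ᵐ ω ∂P, X ω ≤ t) : posMoment P X r t = 0 := by
  refine integral_eq_zero_of_ae ?_
  filter_upwards [h] with ω hω
  simp [max_eq_right (sub_nonpos.2 hω), Real.zero_rpow hr]

theorem posNorm_eq_zero (hα : α ≠ 0) (h : ∀ᵐ ω ∂P, X ω ≤ t) : posNorm P X α t = 0 := by
  rw [posNorm, posMoment_eq_zero hα h, Real.zero_rpow (one_div_ne_zero hα)]

theorem posNorm_rpow (hα : α ≠ 0) : posNorm P X α t ^ α = posMoment P X α t := by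
  rw [posNorm, ← Real.rpow_mul posMoment_nonneg, one_div_mul_cancel hα, Real.rpow_one]

theorem posMoment_anti (hX : X ∈ RVPow P α) (hr : 0 ≤ r) (hrα : r ≤ α) (hst : s ≤ t) :
    posMoment P X r t ≤ posMoment P X r s :=
  integral_mono (integrable_max_sub_rpow hX hr hrα t) (integrable_max_sub_rpow hX hr hrα s)
    fun _ => Real.rpow_le_rpow (le_max_right _ _)
      (max_le_max (sub_le_sub_left hst _) le_rfl) hr

theorem posNorm_anti (hX : X ∈ RVPow P α) (hα : 0 < α) (hst : s ≤ t) :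
    posNorm P X α t ≤ posNorm P X α s :=
  Real.rpow_le_rpow posMoment_nonneg (posMoment_anti hX hα.le le_rfl hst) (by positivity)

theorem continuous_posMoment (hX : X ∈ RVPow P α) (hr : 0 < r) (hrα : r ≤ α) :
    Continuous (posMoment P X r) := by
  refine continuous_iff_continuousAt.2 fun t => ?_
  refine continuousAt_of_dominated (bound := fun ω => (max (X ω - (t - 1)) 0) ^ r)
    (Eventually.of_forall fun u => (measurable_max_sub_rpow hX.1 u r).aestronglyMeasurable) ?_
    (integrable_max_sub_rpow hX hr.le hrα _) (ae_of_all _ fun ω => ?_)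
  · filter_upwards [lt_mem_nhds (sub_one_lt t)] with u hu
    refine ae_of_all _ fun ω => ?_
    rw [Real.norm_of_nonneg (max_rpow_nonneg _ _)]
    exact Real.rpow_le_rpow (le_max_right _ _) (max_le_max (sub_le_sub_left hu.le _) le_rfl) hr.le
  · exact (((continuous_const.sub continuous_id).max continuous_const).rpow_const
      fun _ => Or.inr hr.le).continuousAt

theorem continuous_posNorm (hX : X ∈ RVPow P α) (hα : 0 < α) : Continuous (posNorm P X α) :=
  (continuous_posMoment hX hα le_rfl).rpow_const fun _ => Or.inr (by positivity)

theorem continuous_Bfun (hX : X ∈ RVPow P α) (hα : 0 < α) : Continuous (Bfun P α X p) := by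
  have : Bfun P α X p = fun t => t + posNorm P X α t / p ^ (1 / α) := funext fun _ => Bfun_eq
  rw [this]
  exact continuous_id.add ((continuous_posNorm hX hα).div_const _)

theorem tailProb_nonneg : 0 ≤ tailProb P X t := measureReal_nonneg

/-- Markov-type lower bound for `‖(X - t)_+‖_α`. -/
theorem mul_rpow_le_posNorm (hX : X ∈ RVPow P α) (hα : 0 < α) {y : ℝ} (hty : t ≤ y) :
    (y - t) * tailProb P X y ^ (1 / α) ≤ posNorm P X α t := by
  have h0 : 0 ≤ y - t := sub_nonneg.2 hty
  have hS : MeasurableSet {ω | y ≤ X ω} := measurableSet_le measurable_const hX.1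
  have h : (y - t) ^ α * tailProb P X y ≤ posMoment P X α t := by
    have h1 : ∫ ω in {ω | y ≤ X ω}, (y - t) ^ α ∂P ≤
        ∫ ω in {ω | y ≤ X ω}, (max (X ω - t) 0) ^ α ∂P := by
      refine setIntegral_mono_on (integrable_const _).integrableOn
        (integrable_max_sub_rpow hX hα.le le_rfl t).integrableOn hS fun ω hω => ?_
      exact Real.rpow_le_rpow h0 (le_max_of_le_left (sub_le_sub_right hω t)) hα.le
    rw [setIntegral_const, smul_eq_mul] at h1
    refine le_trans (le_of_eq (mul_comm _ _)) (h1.trans ?_)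
    exact setIntegral_le_integral (integrable_max_sub_rpow hX hα.le le_rfl t)
      (ae_of_all _ fun ω => max_rpow_nonneg _ _)
  calc (y - t) * tailProb P X y ^ (1 / α)
      = ((y - t) ^ α * tailProb P X y) ^ (1 / α) := by
        rw [Real.mul_rpow (Real.rpow_nonneg h0 _) tailProb_nonneg, ← Real.rpow_mul h0,
          mul_one_div_cancel hα.ne', Real.rpow_one]
    _ ≤ _ := Real.rpow_le_rpow (mul_nonneg (Real.rpow_nonneg h0 _) tailProb_nonneg) h
        (by positivity)

theorem le_Bfun (hp : 0 < p) : t ≤ Bfun P α X p t := by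
  rw [Bfun_eq]
  have := posNorm_nonneg (P := P) (X := X) (α := α) (t := t)
  have : 0 ≤ posNorm P X α t / p ^ (1 / α) := by positivity
  linarith

/-- This linear bound serves three times: for growth of B at -∞, for minimality at an atom of mass
at least p, and for the limit α → ∞. -/
theorem add_mul_le_Bfun (hX : X ∈ RVPow P α) (hα : 0 < α) (hp : 0 < p) {y : ℝ} (hty : t ≤ y) :
    t + (y - t) * (tailProb P X y / p) ^ (1 / α) ≤ Bfun P α X p t := by
  rw [Bfun_eq, Real.div_rpow tailProb_nonneg hp.le, ← mul_div_assoc]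
  have := mul_rpow_le_posNorm hX hα hty
  gcongr

theorem Bfun_eq_self (hα : α ≠ 0) (h : ∀ᵐ ω ∂P, X ω ≤ t) : Bfun P α X p t = t := by
  rw [Bfun_eq, posNorm_eq_zero hα h, zero_div, add_zero]

theorem tendsto_Bfun_atTop (hp : 0 < p) : Tendsto (Bfun P α X p) atTop atTop :=
  tendsto_atTop_mono (fun _ => le_Bfun hp) tendsto_id

theorem tendsto_Bfun_atBot (hX : X ∈ RVPow P α) (hα : 0 < α) (hp : 0 < p) (hp1 : p < 1) :
    Tendsto (Bfun P α X p) atBot atTop := by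
  obtain ⟨y, hy⟩ := exists_tailProb_gt (P := P) (X := X) hp1
  set c := (tailProb P X y / p) ^ (1 / α) with hc
  have hc1 : 1 < c := Real.one_lt_rpow ((one_lt_div hp).2 hy) (by positivity)
  have h1 : Tendsto (fun t : ℝ => y * c + -t * (c - 1)) atBot atTop :=
    tendsto_atTop_add_const_left _ _ (tendsto_neg_atBot_atTop.atTop_mul_const (by linarith))
  refine tendsto_atTop_mono' _ ?_ h1
  filter_upwards [eventually_le_atBot y] with t ht
  refine le_trans (le_of_eq ?_) (add_mul_le_Bfun hX hα hp ht)
  rw [← hc]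
  ring

theorem lowerQ_eq_of_isGreatest {τ : ℝ} (h : IsGreatest (argminB P α X p) τ) :
    lowerQ P α X p = τ := h.csSup_eq

/-- B is continuous and coercive, so a minimizer exists. The set of minimizers is closed, and t ≤
B(t) bounds it above by the minimum value. -/
theorem isGreatest_lowerQ (hα : 1 ≤ α) (hX : X ∈ RVPow P α) (hp : p ∈ Ioo (0 : ℝ) 1) :
    IsGreatest (argminB P α X p) (lowerQ P α X p) := by
  have hα0 : 0 < α := by linarith
  have hcont := continuous_Bfun (p := p) hX hα0
  have hlim : Tendsto (Bfun P α X p) (cocompact ℝ) atTop := by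
    rw [cocompact_eq_atBot_atTop]
    exact (tendsto_Bfun_atBot hX hα0 hp.1 hp.2).sup (tendsto_Bfun_atTop hp.1)
  obtain ⟨τ, hτ⟩ := hcont.exists_forall_le hlim
  have hne : (argminB P α X p).Nonempty := ⟨τ, hτ⟩
  have hcl : IsClosed (argminB P α X p) := by
    simp only [argminB, ofPred_forall]
    exact isClosed_iInter fun s => isClosed_le hcont continuous_const
  have hbd : BddAbove (argminB P α X p) :=
    ⟨Bfun P α X p τ, fun t ht => (le_Bfun hp.1).trans (ht τ)⟩
  exact ⟨hcl.csSup_mem hne hbd, fun t ht => le_csSup hbd ht⟩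

theorem isGreatest_argminB {τ : ℝ} (h1 : ∀ s, Bfun P α X p τ ≤ Bfun P α X p s)
    (h2 : ∀ s, τ < s → Bfun P α X p τ < Bfun P α X p s) : IsGreatest (argminB P α X p) τ := by
  refine ⟨h1, fun s hs => ?_⟩
  by_contra! hlt
  exact (h2 s hlt).not_ge (hs τ)

/-- The case of an atom at the top of mass at least `p`. -/
theorem isGreatest_argminB_of_le_atom (hα : 1 ≤ α) (hX : X ∈ RVPow P α) (hp : 0 < p) {x : ℝ}
    (hle : ∀ᵐ ω ∂P, X ω ≤ x) (hpx : p ≤ P.real {ω | X ω = x}) :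
    IsGreatest (argminB P α X p) x := by
  have hα0 : 0 < α := by linarith
  have hB : ∀ s, x ≤ s → Bfun P α X p s = s := fun s hs =>
    Bfun_eq_self hα0.ne' (hle.mono fun _ hω => hω.trans hs)
  refine isGreatest_argminB (fun s => ?_) fun s hs => ?_
  · rw [hB x le_rfl]
    rcases le_total s x with hs | hs
    · refine le_trans ?_ (add_mul_le_Bfun hX hα0 hp hs)
      have h1 : p ≤ tailProb P X x := hpx.trans (measureReal_mono fun ω hω => (Eq.symm hω).le)
      have h2 : 1 ≤ (tailProb P X x / p) ^ (1 / α) :=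
        Real.one_le_rpow ((one_le_div hp).2 h1) (by positivity)
      nlinarith [mul_le_mul_of_nonneg_left h2 (sub_nonneg.2 hs)]
    · rwa [hB s hs]
  · rwa [hB x le_rfl, hB s hs.le]

theorem lowerQ_of_le_pStar (hα : 1 ≤ α) (hX : X ∈ RVPow P α) (hp : 0 < p)
    (h : p ≤ pStar P X) : (lowerQ P α X p : EReal) = xStar P X := by
  obtain ⟨x, hx, hpx⟩ := exists_xStar_eq_coe_of_pStar_pos (hp.trans_le h)
  rw [lowerQ_eq_of_isGreatest (isGreatest_argminB_of_le_atom hα hX hp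
    (ae_le_of_xStar_le hX.1 hx.le) (hpx ▸ h)), hx]

theorem quantileZero_of_le_pStar (hX : Measurable X) (hp : 0 < p)
    (h : p ≤ pStar P X) : (quantileZero P X p : EReal) = xStar P X := by
  obtain ⟨x, hx, hpx⟩ := exists_xStar_eq_coe_of_pStar_pos (hp.trans_le h)
  have hset : {y : ℝ | tailProb P X y < p} = Ioi x := by
    ext y
    refine ⟨fun hy => ?_, fun hy => ?_⟩
    · by_contra hle
      refine (lt_of_lt_of_le hy (h.trans (hpx.le.trans ?_))).false
      exact measureReal_mono fun ω hω => (not_lt.1 hle).trans (Eq.symm hω).le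
    · have : tailProb P X y = 0 := by
        rw [tailProb, measureReal_eq_zero_iff, ← compl_compl {ω | y ≤ X ω}, ← mem_ae_iff]
        filter_upwards [ae_le_of_xStar_le hX hx.le] with ω hω
        exact not_le.2 (hω.trans_lt hy)
      exact this.trans_lt hp
  rw [quantileZero, hset, csInf_Ioi, hx]

end Moments

/-! ### The supporting line of the norm and the equation for the minimizer when α > 1 -/

section LowerP

variable {Ω : Type*} [MeasurableSpace Ω] {P : Measure Ω} [IsProbabilityMeasure P] {X : Ω → ℝ}
  {α r s t p : ℝ}

theorem lowerP_eq (hα : 1 < α) (t : ℝ) :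
    lowerP P α X t = posMoment P X (α - 1) t ^ α / posMoment P X α t ^ (α - 1) := by
  have h1 : α - 1 ≠ 0 := by linarith
  have h2 : α ≠ 0 := by linarith
  rw [lowerP, gNorm_max_sub, gNorm_max_sub, Real.div_rpow posNorm_nonneg posNorm_nonneg,
    Real.rpow_mul posNorm_nonneg, posNorm_rpow h1, mul_comm (α - 1) α,
    Real.rpow_mul posNorm_nonneg, posNorm_rpow h2]

theorem lowerP_nonneg : 0 ≤ lowerP P α X t := by
  rw [lowerP, gNorm_max_sub, gNorm_max_sub]
  exact Real.rpow_nonneg (div_nonneg posNorm_nonneg posNorm_nonneg) _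

theorem lowerP_rpow_inv (hα : 1 < α) (t : ℝ) :
    lowerP P α X t ^ (1 / α) = posMoment P X (α - 1) t / posNorm P X α t ^ (α - 1) := by
  have h2 : α ≠ 0 := by linarith
  rw [lowerP_eq hα, Real.div_rpow (Real.rpow_nonneg posMoment_nonneg _)
    (Real.rpow_nonneg posMoment_nonneg _), ← Real.rpow_mul posMoment_nonneg,
    mul_one_div_cancel h2, Real.rpow_one, posNorm, ← Real.rpow_mul posMoment_nonneg,
    ← Real.rpow_mul posMoment_nonneg]
  congr 2
  ring

theorem lowerP_pos (hα : 1 < α) (hX : X ∈ RVPow P α) (ht : (t : EReal) < xStar P X) :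
    0 < lowerP P α X t := by
  rw [lowerP_eq hα]
  have h1 := posMoment_pos hX (sub_pos.2 hα).le (by linarith) ht
  have h2 := posMoment_pos hX (by linarith : 0 ≤ α) le_rfl ht
  positivity

theorem integrable_max_mul_rpow (hα : 1 < α) (hX : X ∈ RVPow P α) (s t : ℝ) :
    Integrable (fun ω => max (X ω - s) 0 * (max (X ω - t) 0) ^ (α - 1)) P := by
  have hα0 : 0 < α := by linarith
  refine (integrable_rpow_mul_rpow (θ := 1 / α) (integrable_max_sub_rpow hX hα0.le le_rfl s)
    (integrable_max_sub_rpow hX hα0.le le_rfl t) (fun _ => max_rpow_nonneg _ _)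
    (fun _ => max_rpow_nonneg _ _) (by positivity) ((div_lt_one hα0).2 hα)).congr
    (ae_of_all _ fun ω => ?_)
  simp only
  rw [← Real.rpow_mul (le_max_right _ _), ← Real.rpow_mul (le_max_right _ _),
    mul_one_div_cancel hα0.ne', Real.rpow_one]
  congr 2
  field_simp

/-- Puts the mixed moment into the form of Hölder's inequality with θ = 1/α, applied to the α-th
powers. -/
theorem integral_max_mul_rpow_eq (hα : 1 < α) (s t : ℝ) :
    ∫ ω, max (X ω - s) 0 * (max (X ω - t) 0) ^ (α - 1) ∂P =
      ∫ ω, ((max (X ω - s) 0) ^ α) ^ (1 / α) * ((max (X ω - t) 0) ^ α) ^ (1 - 1 / α) ∂P := by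
  have hα0 : 0 < α := by linarith
  congr 1 with ω
  rw [← Real.rpow_mul (le_max_right _ _), ← Real.rpow_mul (le_max_right _ _),
    mul_one_div_cancel hα0.ne', Real.rpow_one]
  congr 2
  field_simp

theorem posNorm_mul_posNorm_rpow (hα : 1 < α) :
    posNorm P X α s * posNorm P X α t ^ (α - 1) =
      posMoment P X α s ^ (1 / α) * posMoment P X α t ^ (1 - 1 / α) := by
  have hα0 : 0 < α := by linarith
  rw [posNorm, posNorm, ← Real.rpow_mul posMoment_nonneg]
  congr 2
  field_simp

theorem integral_max_mul_rpow_le (hα : 1 < α) (hX : X ∈ RVPow P α) (s t : ℝ) :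
    ∫ ω, max (X ω - s) 0 * (max (X ω - t) 0) ^ (α - 1) ∂P ≤
      posNorm P X α s * posNorm P X α t ^ (α - 1) := by
  have hα0 : 0 < α := by linarith
  rw [integral_max_mul_rpow_eq hα, posNorm_mul_posNorm_rpow hα]
  exact integral_rpow_mul_rpow_le (integrable_max_sub_rpow hX hα0.le le_rfl s)
    (integrable_max_sub_rpow hX hα0.le le_rfl t) (fun _ => max_rpow_nonneg _ _)
    (fun _ => max_rpow_nonneg _ _) (by positivity) ((div_lt_one hα0).2 hα)

theorem integral_max_mul_rpow_lt (hα : 1 < α) (hX : X ∈ RVPow P α) (hst : s < t)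
    (hs : (s : EReal) < xStarStar P X) (ht : (t : EReal) < xStar P X) :
    ∫ ω, max (X ω - s) 0 * (max (X ω - t) 0) ^ (α - 1) ∂P <
      posNorm P X α s * posNorm P X α t ^ (α - 1) := by
  have hα0 : 0 < α := by linarith
  have hps := posMoment_pos hX hα0.le le_rfl (hs.trans_le xStarStar_le_xStar)
  have hpt := posMoment_pos hX hα0.le le_rfl ht
  rw [integral_max_mul_rpow_eq hα, posNorm_mul_posNorm_rpow hα]
  refine integral_rpow_mul_rpow_lt (integrable_max_sub_rpow hX hα0.le le_rfl s)
    (integrable_max_sub_rpow hX hα0.le le_rfl t) (fun _ => max_rpow_nonneg _ _)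
    (fun _ => max_rpow_nonneg _ _) (by positivity) ((div_lt_one hα0).2 hα) hps hpt fun h => ?_
  change ∀ᵐ ω ∂P, _ / posMoment P X α s = _ / posMoment P X α t at h
  have hNs := posNorm_pos hX hα0.le (hs.trans_le xStarStar_le_xStar)
  have hNt := posNorm_pos hX hα0.le ht
  have h' : ∀ᵐ ω ∂P, max (X ω - s) 0 / posNorm P X α s = max (X ω - t) 0 / posNorm P X α t := by
    filter_upwards [h] with ω hω
    rw [← posNorm_rpow hα0.ne', ← posNorm_rpow hα0.ne', ← Real.div_rpow (le_max_right _ _) hNs.le,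
      ← Real.div_rpow (le_max_right _ _) hNt.le] at hω
    exact (Real.rpow_left_inj (div_nonneg (le_max_right _ _) hNs.le)
      (div_nonneg (le_max_right _ _) hNt.le) hα0.ne').1 hω
  set a := posNorm P X α s
  set b := posNorm P X α t
  -- Equality in Hölder means (X-s)_+/a = (X-t)_+/b. The constant is the only x with (x-s)/a =
  -- (x-t)/b; here a ≠ b because s < t.
  refine not_ae_eq_const_of_lt_xStarStar hX.1 hs ((s * b - t * a) / (b - a)) ?_
  filter_upwards [h'] with ω hω hsX
  have hX0 : 0 < X ω - s := sub_pos.2 hsX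
  rw [max_eq_left hX0.le, div_eq_div_iff hNs.ne' hNt.ne'] at hω
  have htX : 0 < max (X ω - t) 0 := by
    by_contra! hle
    rw [le_antisymm hle (le_max_right _ _), zero_mul] at hω
    exact (mul_pos hX0 hNt).ne' hω
  have htX' : 0 < X ω - t := (lt_max_iff.1 htX).resolve_right (lt_irrefl _)
  rw [max_eq_left htX'.le] at hω
  have hne : b - a ≠ 0 := by
    intro hab
    have : b = a := by linarith
    rw [this] at hω
    have := mul_right_cancel₀ hNs.ne' hω
    linarith
  rw [eq_div_iff hne]
  linarith

/-- Pointwise, (X-t) + (t-s) = X-s ≤ (X-s)_+ where X > t, and both sides vanish elsewhere since α-1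
> 0. -/
theorem add_mul_posMoment_le (hα : 1 < α) (hX : X ∈ RVPow P α) (s t : ℝ) :
    posMoment P X α t + (t - s) * posMoment P X (α - 1) t ≤
      ∫ ω, max (X ω - s) 0 * (max (X ω - t) 0) ^ (α - 1) ∂P := by
  have h1 : α - 1 ≠ 0 := by linarith
  have i1 := integrable_max_sub_rpow hX (by linarith) le_rfl t
  have i2 := integrable_max_sub_rpow (r := α - 1) hX (by linarith) (by linarith) t
  rw [posMoment, posMoment, ← integral_const_mul, ← integral_add i1 (i2.const_mul _)]
  refine integral_mono (i1.add (i2.const_mul _)) (integrable_max_mul_rpow hα hX s t) fun ω => ?_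
  simp only
  rcases le_or_gt (X ω - t) 0 with h | h
  · rw [max_eq_right h, Real.zero_rpow h1, Real.zero_rpow (by linarith)]
    simp
  · rw [max_eq_left h.le]
    have h2 : (X ω - t) ^ α = (X ω - t) * (X ω - t) ^ (α - 1) := by
      rw [← Real.rpow_one_add' h.le (by linarith)]
      congr 1
      ring
    rw [h2, ← add_mul]
    refine mul_le_mul_of_nonneg_right ?_ (Real.rpow_nonneg h.le _)
    exact le_max_of_le_left (by linarith)

/-- `-(lowerP)^(1/α)` is a subgradient of the convex function `t ↦ ‖(X - t)_+‖_α`. -/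
theorem posNorm_tangent (hα : 1 < α) (hX : X ∈ RVPow P α) (ht : (t : EReal) < xStar P X) (s : ℝ) :
    posNorm P X α t + (t - s) * lowerP P α X t ^ (1 / α) ≤ posNorm P X α s := by
  have hα0 : 0 < α := by linarith
  have hN := posNorm_pos hX hα0.le ht
  have h := (add_mul_posMoment_le hα hX s t).trans (integral_max_mul_rpow_le hα hX s t)
  have h2 : posMoment P X α t = posNorm P X α t * posNorm P X α t ^ (α - 1) := by
    rw [← Real.rpow_one_add' hN.le (by linarith), ← posNorm_rpow hα0.ne']
    congr 1
    ring
  rw [lowerP_rpow_inv hα, ← mul_le_mul_iff_left₀ (Real.rpow_pos_of_pos hN (α - 1)), add_mul,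
    ← h2, mul_assoc, div_mul_cancel₀ _ (Real.rpow_pos_of_pos hN (α - 1)).ne']
  exact h

theorem posNorm_tangent_lt (hα : 1 < α) (hX : X ∈ RVPow P α) (hst : s < t)
    (hs : (s : EReal) < xStarStar P X) (ht : (t : EReal) < xStar P X) :
    posNorm P X α t + (t - s) * lowerP P α X t ^ (1 / α) < posNorm P X α s := by
  have hα0 : 0 < α := by linarith
  have hN := posNorm_pos hX hα0.le ht
  have h := (add_mul_posMoment_le hα hX s t).trans_lt (integral_max_mul_rpow_lt hα hX hst hs ht)
  have h2 : posMoment P X α t = posNorm P X α t * posNorm P X α t ^ (α - 1) := by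
    rw [← Real.rpow_one_add' hN.le (by linarith), ← posNorm_rpow hα0.ne']
    congr 1
    ring
  rw [lowerP_rpow_inv hα, ← mul_lt_mul_iff_left₀ (Real.rpow_pos_of_pos hN (α - 1)), add_mul,
    ← h2, mul_assoc, div_mul_cancel₀ _ (Real.rpow_pos_of_pos hN (α - 1)).ne']
  exact h

/-- Add the supporting line at t evaluated at s, which is strict, to the one at s evaluated at t. -/
theorem lowerP_lt_lowerP (hα : 1 < α) (hX : X ∈ RVPow P α) (hst : s < t)
    (hs : (s : EReal) < xStarStar P X) (ht : (t : EReal) < xStar P X) :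
    lowerP P α X t < lowerP P α X s := by
  have h1 := posNorm_tangent_lt hα hX hst hs ht
  have h2 := posNorm_tangent hα hX (hs.trans_le xStarStar_le_xStar) t
  have h3 : (t - s) * lowerP P α X t ^ (1 / α) < (t - s) * lowerP P α X s ^ (1 / α) := by linarith
  have h4 := lt_of_mul_lt_mul_left h3 (by linarith)
  exact (Real.rpow_lt_rpow_iff lowerP_nonneg lowerP_nonneg (by positivity)).1 h4

theorem lowerP_anti (hα : 1 < α) (hX : X ∈ RVPow P α) (hst : s ≤ t)
    (ht : (t : EReal) < xStar P X) : lowerP P α X t ≤ lowerP P α X s := by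
  rcases hst.eq_or_lt with rfl | hst
  · exact le_rfl
  have h1 := posNorm_tangent hα hX ht s
  have h2 := posNorm_tangent hα hX ((EReal.coe_lt_coe_iff.2 hst).trans ht) t
  have h3 : (t - s) * lowerP P α X t ^ (1 / α) ≤ (t - s) * lowerP P α X s ^ (1 / α) := by linarith
  have h4 := le_of_mul_le_mul_left h3 (by linarith)
  exact (Real.rpow_le_rpow_iff lowerP_nonneg lowerP_nonneg (by positivity)).1 h4

/-- Hölder applied to the indicator of {X > t} times (X-t)_+^{α-1}. -/
theorem lowerP_le_real_gt (hα : 1 < α) (hX : X ∈ RVPow P α) (ht : (t : EReal) < xStar P X) :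
    lowerP P α X t ≤ P.real {ω | t < X ω} := by
  have hα0 : 0 < α := by linarith
  have hS : MeasurableSet {ω | t < X ω} := measurableSet_lt measurable_const hX.1
  have hi : Integrable ({ω | t < X ω}.indicator fun _ => (1 : ℝ)) P :=
    (integrable_const 1).indicator hS
  have h := integral_rpow_mul_rpow_le (θ := 1 / α) hi (integrable_max_sub_rpow hX hα0.le le_rfl t)
    (fun ω => indicator_nonneg (fun _ _ => zero_le_one) ω)
    (fun _ => max_rpow_nonneg _ _) (by positivity) ((div_lt_one hα0).2 hα)
  have h1 : ∫ ω, ({ω | t < X ω}.indicator (fun _ => (1 : ℝ)) ω) ^ (1 / α) *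
      ((max (X ω - t) 0) ^ α) ^ (1 - 1 / α) ∂P = posMoment P X (α - 1) t := by
    rw [posMoment]
    congr 1 with ω
    rw [← Real.rpow_mul (le_max_right _ _), show α * (1 - 1 / α) = α - 1 by field_simp]
    by_cases hω : t < X ω
    · rw [indicator_of_mem (by exact hω)]
      simp
    · rw [max_eq_right (by linarith), Real.zero_rpow (by linarith), mul_zero]
  rw [h1, integral_indicator hS, setIntegral_const, smul_eq_mul, mul_one] at h
  have hM := posMoment_pos hX hα0.le le_rfl ht
  rw [lowerP_eq hα, div_le_iff₀ (by positivity)]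
  refine (Real.rpow_le_rpow posMoment_nonneg h hα0.le).trans (le_of_eq ?_)
  rw [Real.mul_rpow (Real.rpow_nonneg measureReal_nonneg _) (by positivity),
    ← Real.rpow_mul measureReal_nonneg, one_div_mul_cancel hα0.ne', Real.rpow_one,
    ← posMoment, ← Real.rpow_mul hM.le, show (1 - 1 / α) * α = α - 1 by field_simp]

/-- For an atom at x = x_*, the norm vanishes at x, so the supporting line at t bounds N(t) above by
(x-t) P(t)^{1/α}. The Markov-type bound gives N(t) ≥ (x-t) P(X ≥ x)^{1/α}. -/
theorem pStar_le_lowerP (hα : 1 < α) (hX : X ∈ RVPow P α) (ht : (t : EReal) < xStar P X) :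
    pStar P X ≤ lowerP P α X t := by
  have hα0 : 0 < α := by linarith
  rcases (pStar_nonneg (P := P) (X := X)).eq_or_lt with h0 | h0
  · exact h0 ▸ lowerP_nonneg
  obtain ⟨x, hx, hpx⟩ := exists_xStar_eq_coe_of_pStar_pos h0
  have htx : t < x := EReal.coe_lt_coe_iff.1 (hx ▸ ht)
  have h1 := posNorm_tangent hα hX ht x
  rw [posNorm_eq_zero hα0.ne' (ae_le_of_xStar_le hX.1 hx.le)] at h1
  have h2 := mul_rpow_le_posNorm hX hα0 htx.le
  have h3 : pStar P X ≤ tailProb P X x := hpx.le.trans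
    (measureReal_mono fun ω hω => (Eq.symm hω).le)
  have h4 : (x - t) * tailProb P X x ^ (1 / α) ≤ (x - t) * lowerP P α X t ^ (1 / α) := by
    linarith
  have h5 := le_of_mul_le_mul_left h4 (by linarith)
  exact h3.trans ((Real.rpow_le_rpow_iff measureReal_nonneg lowerP_nonneg (by positivity)).1 h5)

theorem continuousOn_lowerP (hα : 1 < α) (hX : X ∈ RVPow P α) :
    ContinuousOn (lowerP P α X) {t : ℝ | (t : EReal) < xStar P X} := by
  have : lowerP P α X = fun t => posMoment P X (α - 1) t ^ α / posMoment P X α t ^ (α - 1) :=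
    funext fun t => lowerP_eq hα t
  rw [this]
  refine ContinuousOn.div ?_ ?_ fun t ht => ?_
  · exact ((continuous_posMoment hX (sub_pos.2 hα) (by linarith)).rpow_const
      fun _ => Or.inr (by linarith)).continuousOn
  · exact ((continuous_posMoment hX (by linarith) le_rfl).rpow_const
      fun _ => Or.inr (by linarith)).continuousOn
  · exact (Real.rpow_pos_of_pos (posMoment_pos hX (by linarith) le_rfl ht) _).ne'

theorem Bfun_tangent (hα : 1 < α) (hX : X ∈ RVPow P α) (hp : 0 < p)
    (ht : (t : EReal) < xStar P X) (s : ℝ) :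
    Bfun P α X p t + (s - t) * (1 - (lowerP P α X t / p) ^ (1 / α)) ≤ Bfun P α X p s := by
  rw [Bfun_eq, Bfun_eq, Real.div_rpow lowerP_nonneg hp.le]
  have hpp : 0 < p ^ (1 / α) := Real.rpow_pos_of_pos hp _
  have h := div_le_div_of_nonneg_right (posNorm_tangent hα hX ht s) hpp.le
  rw [add_div, mul_div_assoc] at h
  linarith

/-- If P(t) ≤ p, the supporting line at t would give B(t) ≤ B(s) for t < s, contrary to the growth
of B at -∞. This avoids computing the limit of P. -/
theorem exists_lowerP_gt (hα : 1 < α) (hX : X ∈ RVPow P α) (hp : p ∈ Ioo (0 : ℝ) 1) (s : ℝ) :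
    ∃ t < s, (t : EReal) < xStar P X ∧ p < lowerP P α X t := by
  have hα0 : 0 < α := by linarith
  obtain ⟨y, hy⟩ : ∃ y : ℝ, (y : EReal) < xStar P X := by
    obtain ⟨y, -, hy⟩ := EReal.lt_iff_exists_real_btwn.1 (bot_lt_xStar (P := P) hX.1)
    exact ⟨y, hy⟩
  have hlim := tendsto_Bfun_atBot hX hα0 hp.1 hp.2
  obtain ⟨t, ht1, ht2, ht3⟩ := ((hlim.eventually_gt_atTop (Bfun P α X p s)).and
    ((eventually_lt_atBot s).and (eventually_lt_atBot y))).exists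
  have htx : (t : EReal) < xStar P X := (EReal.coe_lt_coe_iff.2 ht3).trans hy
  refine ⟨t, ht2, htx, ?_⟩
  by_contra! hle
  have h1 := Bfun_tangent hα hX hp.1 htx s
  have h2 : (lowerP P α X t / p) ^ (1 / α) ≤ 1 :=
    Real.rpow_le_one (div_nonneg lowerP_nonneg hp.1.le) ((div_le_one hp.1).2 hle) (by positivity)
  nlinarith [mul_nonneg (sub_nonneg.2 ht2.le) (sub_nonneg.2 h2)]

theorem lt_xStarStar_of_lowerP_gt (hα : 1 < α) (hX : X ∈ RVPow P α) (ht : (t : EReal) < xStar P X)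
    (hp : pStar P X < lowerP P α X t) : (t : EReal) < xStarStar P X := by
  by_contra! hle
  exact (hp.trans_le (lowerP_le_real_gt hα hX ht)).ne' (real_gt_eq_pStar hX.1 hle ht)

theorem pStar_lt_lowerP (hα : 1 < α) (hX : X ∈ RVPow P α) (ht : (t : EReal) < xStarStar P X) :
    pStar P X < lowerP P α X t := by
  obtain ⟨u, htu, hu⟩ := EReal.lt_iff_exists_real_btwn.1 (ht.trans_le xStarStar_le_xStar)
  exact (pStar_le_lowerP hα hX hu).trans_lt
    (lowerP_lt_lowerP hα hX (EReal.coe_lt_coe_iff.1 htu) ht hu)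

theorem exists_lowerP_eq (hα : 1 < α) (hX : X ∈ RVPow P α) (hp : p ∈ Ioo (pStar P X) 1) :
    ∃ t : ℝ, (t : EReal) < xStar P X ∧ lowerP P α X t = p := by
  have hp0 : 0 < p := pStar_nonneg.trans_lt hp.1
  obtain ⟨b, hb, hbp⟩ := exists_real_gt_lt hX.1 hp.1
  obtain ⟨a, hab, -, hap⟩ := exists_lowerP_gt hα hX ⟨hp0, hp.2⟩ b
  have hc : ContinuousOn (lowerP P α X) (Icc a b) := (continuousOn_lowerP hα hX).mono
    fun t ht => (EReal.coe_le_coe_iff.2 ht.2).trans_lt hb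
  obtain ⟨t, ht, htp⟩ := intermediate_value_Icc' hab.le hc
    ⟨((lowerP_le_real_gt hα hX hb).trans_lt hbp).le, hap.le⟩
  exact ⟨t, (EReal.coe_le_coe_iff.2 ht.2).trans_lt hb, htp⟩

/-- A root of `lowerP = p` is the largest minimizer. -/
theorem lowerQ_eq_of_lowerP_eq (hα : 1 < α) (hX : X ∈ RVPow P α) (hp : p ∈ Ioo (pStar P X) 1)
    (ht : (t : EReal) < xStar P X) (htp : lowerP P α X t = p) : lowerQ P α X p = t := by
  have hα0 : 0 < α := by linarith
  have hp0 : 0 < p := pStar_nonneg.trans_lt hp.1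
  have htt : (t : EReal) < xStarStar P X := lt_xStarStar_of_lowerP_gt hα hX ht (htp ▸ hp.1)
  have hmin : ∀ s, Bfun P α X p t ≤ Bfun P α X p s := fun s => by
    have := Bfun_tangent hα hX hp0 ht s
    rwa [htp, div_self hp0.ne', Real.one_rpow, sub_self, mul_zero, add_zero] at this
  refine lowerQ_eq_of_isGreatest (isGreatest_argminB hmin fun s hs => ?_)
  -- Since s may lie at or above x_*, the supporting line is taken at an intermediate u < x_*. There
  -- P(u) < p, so its slope is positive and B(t) ≤ B(u) < B(s).
  obtain ⟨u, htu, hu⟩ := EReal.lt_iff_exists_real_btwn.1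
    (lt_min ht (EReal.coe_lt_coe_iff.2 hs))
  have htu := EReal.coe_lt_coe_iff.1 htu
  have hux := hu.trans_le (min_le_left _ _)
  have hus := EReal.coe_lt_coe_iff.1 (hu.trans_le (min_le_right _ _))
  have hlt := lowerP_lt_lowerP hα hX htu htt hux
  rw [htp] at hlt
  have h1 : (lowerP P α X u / p) ^ (1 / α) < 1 :=
    Real.rpow_lt_one (div_nonneg lowerP_nonneg hp0.le) ((div_lt_one hp0).2 hlt) (by positivity)
  have h2 := Bfun_tangent hα hX hp0 hux s
  have h3 := hmin u
  nlinarith [mul_pos (sub_pos.2 hus) (sub_pos.2 h1)]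

theorem lowerQ_spec (hα : 1 < α) (hX : X ∈ RVPow P α) (hp : p ∈ Ioo (pStar P X) 1) :
    (lowerQ P α X p : EReal) < xStarStar P X ∧ lowerP P α X (lowerQ P α X p) = p := by
  obtain ⟨t, ht, htp⟩ := exists_lowerP_eq hα hX hp
  rw [lowerQ_eq_of_lowerP_eq hα hX hp ht htp]
  exact ⟨lt_xStarStar_of_lowerP_gt hα hX ht (htp ▸ hp.1), htp⟩

theorem lt_lowerQ_iff (hα : 1 < α) (hX : X ∈ RVPow P α) (hp : p ∈ Ioo (pStar P X) 1)
    (ht : (t : EReal) < xStar P X) : t < lowerQ P α X p ↔ p < lowerP P α X t := by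
  obtain ⟨h1, h2⟩ := lowerQ_spec hα hX hp
  refine ⟨fun h => ?_, fun h => ?_⟩
  · rw [← h2]
    exact lowerP_lt_lowerP hα hX h ((EReal.coe_lt_coe_iff.2 h).trans h1)
      (h1.trans_le xStarStar_le_xStar)
  · by_contra! hle
    exact (lowerP_anti hα hX hle ht).not_gt (h2.trans_lt h)

theorem lowerQ_lt_iff (hα : 1 < α) (hX : X ∈ RVPow P α) (hp : p ∈ Ioo (pStar P X) 1)
    (ht : (t : EReal) < xStar P X) : lowerQ P α X p < t ↔ lowerP P α X t < p := by
  obtain ⟨h1, h2⟩ := lowerQ_spec hα hX hp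
  refine ⟨fun h => ?_, fun h => ?_⟩
  · conv_rhs => rw [← h2]
    exact lowerP_lt_lowerP hα hX h h1 ht
  · by_contra! hle
    exact (lowerP_anti hα hX hle (h1.trans_le xStarStar_le_xStar)).not_gt (h.trans_eq h2.symm)

end LowerP

/-! ### The quantile as the case α = 1, and monotonicity in p -/

section Quantile

variable {Ω : Type*} [MeasurableSpace Ω] {P : Measure Ω} [IsProbabilityMeasure P] {X : Ω → ℝ}
  {α β r s t p q : ℝ}

theorem tailProb_anti (h : s ≤ t) : tailProb P X t ≤ tailProb P X s :=
  measureReal_mono fun _ hω => h.trans hω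

theorem le_of_tailProb_lt (h : tailProb P X t < p) (h' : p ≤ tailProb P X s) : s ≤ t := by
  by_contra! hlt
  exact (h'.trans (tailProb_anti hlt.le)).not_gt h

theorem bddBelow_tailProb_lt (hp : p < 1) : BddBelow {x : ℝ | tailProb P X x < p} := by
  obtain ⟨y, hy⟩ := exists_tailProb_gt (P := P) (X := X) hp
  exact ⟨y, fun x hx => le_of_tailProb_lt hx hy.le⟩

theorem tailProb_lt_of_quantileZero_lt (hX : Measurable X) (hp : 0 < p)
    (h : quantileZero P X p < t) : tailProb P X t < p := by
  obtain ⟨u, hu, hut⟩ := exists_lt_of_csInf_lt (exists_tailProb_lt hX hp) h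
  exact (tailProb_anti hut.le).trans_lt hu

theorem le_tailProb_of_lt_quantileZero (hp : p < 1) (h : t < quantileZero P X p) :
    p ≤ tailProb P X t := by
  by_contra! hlt
  exact (csInf_le (bddBelow_tailProb_lt hp) hlt).not_gt h

theorem real_gt_le_of_quantileZero_le (hX : Measurable X) (hp : 0 < p)
    (h : quantileZero P X p ≤ t) : P.real {ω | t < X ω} ≤ p := by
  have hun : ⋃ n : ℕ, {ω | t + 1 / ((n : ℝ) + 1) ≤ X ω} = {ω | t < X ω} := by
    ext ω
    simp only [mem_iUnion]
    refine ⟨fun ⟨n, hn⟩ => ?_, fun hω => ?_⟩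
    · have : (0 : ℝ) < 1 / ((n : ℝ) + 1) := by positivity
      have hn : t + 1 / ((n : ℝ) + 1) ≤ X ω := hn
      show t < X ω
      linarith
    · obtain ⟨n, hn⟩ := exists_nat_one_div_lt (sub_pos.2 (show t < X ω from hω))
      exact ⟨n, show t + 1 / ((n : ℝ) + 1) ≤ X ω by linarith⟩
  have hlim : Tendsto (fun n : ℕ => P {ω | t + 1 / ((n : ℝ) + 1) ≤ X ω}) atTop
      (𝓝 (P (⋃ n : ℕ, {ω | t + 1 / ((n : ℝ) + 1) ≤ X ω}))) := by
    refine tendsto_measure_iUnion_atTop fun m n hmn ω hω => ?_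
    change t + 1 / ((m : ℝ) + 1) ≤ X ω at hω
    change t + 1 / ((n : ℝ) + 1) ≤ X ω
    have : 1 / ((n : ℝ) + 1) ≤ 1 / ((m : ℝ) + 1) := Nat.one_div_le_one_div hmn
    linarith
  rw [hun] at hlim
  refine le_of_tendsto' ((ENNReal.tendsto_toReal (measure_ne_top _ _)).comp hlim) fun n => ?_
  have : (0 : ℝ) < 1 / ((n : ℝ) + 1) := by positivity
  exact (tailProb_lt_of_quantileZero_lt (t := t + 1 / ((n : ℝ) + 1)) hX hp (by linarith)).le

theorem posNorm_one : posNorm P X 1 t = ∫ ω, max (X ω - t) 0 ∂P := by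
  simp [posNorm, posMoment]

/-- The counterpart of `posNorm_tangent` for α = 1; it needs no upper bound on t. -/
theorem posNorm_one_tangent (hX : X ∈ RVPow P 1) (s t : ℝ) :
    posNorm P X 1 t + (t - s) * tailProb P X t ≤ posNorm P X 1 s := by
  have hS : MeasurableSet {ω | t ≤ X ω} := measurableSet_le measurable_const hX.1
  have hi : ∀ u, Integrable (fun ω => max (X ω - u) 0) P := fun u => by
    simpa using integrable_max_sub_rpow hX zero_le_one le_rfl u
  have h1 : Integrable ({ω | t ≤ X ω}.indicator fun _ => t - s) P :=
    (integrable_const _).indicator hS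
  have h2 : ∫ ω, {ω | t ≤ X ω}.indicator (fun _ => t - s) ω ∂P = (t - s) * tailProb P X t := by
    rw [integral_indicator hS, setIntegral_const, smul_eq_mul, mul_comm, tailProb]
  rw [posNorm_one, posNorm_one, ← h2, ← integral_add (hi t) h1]
  refine integral_mono ((hi t).add h1) (hi s) fun ω => ?_
  by_cases hω : t ≤ X ω
  · simp only [indicator_of_mem (show ω ∈ {ω | t ≤ X ω} from hω)]
    rw [max_eq_left (sub_nonneg.2 hω)]
    exact le_max_of_le_left (by linarith)
  · simp only [indicator_of_notMem (show ω ∉ {ω | t ≤ X ω} from hω)]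
    rw [max_eq_right (by linarith), add_zero]
    exact le_max_right _ _

theorem lowerQ_one (hX : X ∈ RVPow P 1) (hp : p ∈ Ioo (0 : ℝ) 1) :
    lowerQ P 1 X p = quantileZero P X p := by
  have hB : ∀ s t, Bfun P 1 X p t + (t - s) * (tailProb P X t - p) / p ≤ Bfun P 1 X p s := by
    intro s t
    have hp0 := hp.1
    have h := div_le_div_of_nonneg_right (posNorm_one_tangent hX s t) hp.1.le
    rw [Bfun_eq, Bfun_eq, one_div_one, Real.rpow_one]
    have h3 : t + posNorm P X 1 t / p + (t - s) * (tailProb P X t - p) / p =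
        s + (posNorm P X 1 t + (t - s) * tailProb P X t) / p := by
      field_simp
      ring
    rw [h3]
    exact add_le_add_right h s
  set q := quantileZero P X p
  have hcont := continuous_Bfun (p := p) hX zero_lt_one
  -- The line is taken at u strictly between s and q, where the sign of P(X ≥ u) - p is known; then
  -- u → q by continuity.
  have hleft : ∀ s < q, Bfun P 1 X p q ≤ Bfun P 1 X p s := fun s hs => by
    refine le_of_tendsto (hcont.continuousWithinAt (s := Iio q) (x := q)).tendsto ?_
    filter_upwards [Ioo_mem_nhdsLT hs] with u hu
    refine le_trans ?_ (hB s u)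
    have h1 := le_tailProb_of_lt_quantileZero hp.2 hu.2
    have : 0 ≤ (u - s) * (tailProb P X u - p) / p :=
      div_nonneg (mul_nonneg (by linarith [hu.1]) (by linarith)) hp.1.le
    linarith
  have hmono : ∀ s u, q < u → u < s → Bfun P 1 X p u < Bfun P 1 X p s := fun s u hu hus => by
    refine lt_of_lt_of_le ?_ (hB s u)
    have h1 := tailProb_lt_of_quantileZero_lt hX.1 hp.1 hu
    have : 0 < (u - s) * (tailProb P X u - p) / p :=
      div_pos (mul_pos_of_neg_of_neg (by linarith) (by linarith)) hp.1
    linarith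
  have hright : ∀ s, q < s → Bfun P 1 X p q ≤ Bfun P 1 X p s := fun s hs => by
    refine le_of_tendsto (hcont.continuousWithinAt (s := Ioi q) (x := q)).tendsto ?_
    filter_upwards [Ioo_mem_nhdsGT hs] with u hu
    exact (hmono s u hu.1 hu.2).le
  refine lowerQ_eq_of_isGreatest (isGreatest_argminB (fun s => ?_) fun s hs => ?_)
  · rcases lt_trichotomy s q with h | h | h
    exacts [hleft s h, h ▸ le_rfl, hright s h]
  · obtain ⟨u, hu, hus⟩ := exists_between hs
    exact (hright u hu).trans_lt (hmono s u hu hus)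

/-- A smaller p puts more weight on the decreasing norm. If the minimizer for q were larger, it
would also minimize B for p, against maximality. -/
theorem lowerQ_anti (hα : 1 ≤ α) (hX : X ∈ RVPow P α) (hp : p ∈ Ioo (0 : ℝ) 1)
    (hq : q ∈ Ioo (0 : ℝ) 1) (hpq : p ≤ q) : lowerQ P α X q ≤ lowerQ P α X p := by
  have hα0 : 0 < α := by linarith
  by_contra! hlt
  have h1 := isGreatest_lowerQ hα hX hp
  have h2 := isGreatest_lowerQ hα hX hq
  have hpp : 0 < p ^ (1 / α) := Real.rpow_pos_of_pos hp.1 _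
  have hppq : p ^ (1 / α) ≤ q ^ (1 / α) := Real.rpow_le_rpow hp.1.le hpq (by positivity)
  have hN := posNorm_anti hX hα0 hlt.le
  have h3 := h2.1 (lowerQ P α X p)
  rw [Bfun_eq, Bfun_eq] at h3
  have h4 := div_le_div_of_nonneg_left (sub_nonneg.2 hN) hpp hppq
  rw [sub_div, sub_div] at h4
  refine hlt.not_ge (h1.2 fun s => le_trans ?_ (h1.1 s))
  rw [Bfun_eq, Bfun_eq]
  linarith

end Quantile

/-! ### Dependence on α: log-convexity of moments and the limits α ↓ 1 and α → ∞ -/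

section Exponent

variable {Ω : Type*} [MeasurableSpace Ω] {P : Measure Ω} [IsProbabilityMeasure P] {X : Ω → ℝ}
  {α β r s t p q : ℝ}

theorem RVPow_anti (hα : 0 ≤ α) (hαβ : α ≤ β) (hX : X ∈ RVPow P β) : X ∈ RVPow P α :=
  ⟨hX.1, by simpa using integrable_max_sub_rpow hX hα hαβ 0⟩

/-- The intercepts of the secants of a strictly convex function over the intervals `[r - 1, r]`
decrease strictly in `r ≥ 1`. -/
theorem StrictConvexOn.intercept_lt {m : ℝ → ℝ} (hαβ : α < β) (h1 : 1 ≤ α)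
    (hm : StrictConvexOn ℝ (Icc 0 β) m) :
    β * m (β - 1) - (β - 1) * m β < α * m (α - 1) - (α - 1) * m α := by
  have mem : ∀ x, 0 ≤ x → x ≤ β → x ∈ Icc 0 β := fun x h h' => ⟨h, h'⟩
  have e1 := hm.secant_strict_mono (mem (α - 1) (by linarith) (by linarith))
    (mem α (by linarith) hαβ.le) (mem β (by linarith) le_rfl) (by linarith) (by linarith) hαβ
  have e2 := hm.secant_strict_mono (mem β (by linarith) le_rfl)
    (mem (α - 1) (by linarith) (by linarith)) (mem (β - 1) (by linarith) (by linarith))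
    (by linarith) (by linarith) (by linarith)
  rw [sub_sub_cancel, div_one] at e1
  rw [show β - 1 - β = -1 by ring, div_neg, div_one, neg_sub] at e2
  have e3 : (m β - m (α - 1)) / (β - (α - 1)) = (m (α - 1) - m β) / (α - 1 - β) := by
    rw [← neg_sub (m β), ← neg_sub β, neg_div_neg_eq]
  have hs : m α - m (α - 1) < m β - m (β - 1) := e1.trans (e3.trans_lt e2)
  -- The chord slopes are now ordered. If the intervals overlap, m(β-1) lies below the first chord;
  -- otherwise the gap from α to β-1 has slope at most that of the last chord.
  rcases lt_or_ge (β - 1) α with hc | hc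
  · have e4 := hm.secant_strict_mono (mem (α - 1) (by linarith) (by linarith))
      (mem (β - 1) (by linarith) (by linarith)) (mem α (by linarith) hαβ.le) (by linarith)
      (by linarith) hc
    rw [sub_sub_cancel, div_one, div_lt_iff₀ (by linarith)] at e4
    nlinarith [mul_pos (by linarith : 0 < β - 1) (sub_pos.2 hs)]
  · have e5 : m (β - 1) - m α ≤ (m β - m (β - 1)) * (β - 1 - α) := by
      rcases hc.eq_or_lt with hc | hc
      · rw [← hc]
        simp
      · have := hm.slope_strict_mono_adjacent (mem α (by linarith) hαβ.le)
          (mem β (by linarith) le_rfl) hc (by linarith)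
        rw [sub_sub_cancel, div_one, div_lt_iff₀ (by linarith)] at this
        exact this.le
    nlinarith [mul_pos (by linarith : 0 < α) (sub_pos.2 hs)]

/-- `E (X - t)_+^r` with the convention `0^0 = 0`. -/
noncomputable def tailMoment {Ω : Type*} [MeasurableSpace Ω] (P : Measure Ω) (X : Ω → ℝ)
    (t r : ℝ) : ℝ :=
  ∫ ω in {ω | t < X ω}, (max (X ω - t) 0) ^ r ∂P

theorem tailMoment_zero : tailMoment P X t 0 = P.real {ω | t < X ω} := by
  simp [tailMoment]

theorem tailMoment_eq (hr : r ≠ 0) : tailMoment P X t r = posMoment P X r t := by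
  refine setIntegral_eq_integral_of_forall_compl_eq_zero fun ω hω => ?_
  rw [max_eq_right (by linarith [show ¬ t < X ω from hω]), Real.zero_rpow hr]

theorem tailMoment_pos (hX : X ∈ RVPow P α) (hr : 0 ≤ r) (hrα : r ≤ α)
    (ht : (t : EReal) < xStar P X) : 0 < tailMoment P X t r := by
  rcases hr.eq_or_lt with rfl | hr
  · rw [tailMoment_zero]
    exact real_pos_of_lt_xStar hX.1 ht
  · rw [tailMoment_eq hr.ne']
    exact posMoment_pos hX hr.le hrα ht

theorem strictConvexOn_log_tailMoment (hX : X ∈ RVPow P α) (ht : (t : EReal) < xStarStar P X) :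
    StrictConvexOn ℝ (Icc 0 α) fun r => Real.log (tailMoment P X t r) := by
  refine ⟨convex_Icc 0 α, fun x hx y hy hxy a b ha hb hab => ?_⟩
  have ht' := ht.trans_le xStarStar_le_xStar
  have hS : MeasurableSet {ω | t < X ω} := measurableSet_lt measurable_const hX.1
  have hae : ∀ᵐ ω ∂(P.restrict {ω | t < X ω}), 0 < max (X ω - t) 0 := by
    filter_upwards [ae_restrict_mem hS] with ω hω
    exact lt_max_of_lt_left (sub_pos.2 hω)
  have hpx := tailMoment_pos hX hx.1 hx.2 ht'
  have hpy := tailMoment_pos hX hy.1 hy.2 ht'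
  have hb' : b = 1 - a := by linarith
  have hz : a * x + b * y ∈ Icc 0 α := convex_Icc 0 α hx hy ha.le hb.le hab
  have hpz := tailMoment_pos hX hz.1 hz.2 ht'
  have key := integral_rpow_mul_rpow_lt (θ := a) (μ := P.restrict {ω | t < X ω})
    (integrable_max_sub_rpow hX hx.1 hx.2 t).integrableOn
    (integrable_max_sub_rpow hX hy.1 hy.2 t).integrableOn (fun _ => max_rpow_nonneg _ _)
    (fun _ => max_rpow_nonneg _ _) ha (by linarith) hpx hpy fun h => by
      change ∀ᵐ ω ∂_, _ / tailMoment P X t x = _ / tailMoment P X t y at h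
      -- Equality in Hölder would make (X-t)^{x-y} a constant on {X > t}; solving for X gives this
      -- value.
      refine not_ae_eq_const_of_lt_xStarStar hX.1 ht
        ((tailMoment P X t x / tailMoment P X t y) ^ (1 / (x - y)) + t) ?_
      refine (ae_restrict_iff' hS).1 ?_
      filter_upwards [h, ae_restrict_mem hS] with ω hω hω'
      have h0 : 0 < X ω - t := sub_pos.2 hω'
      rw [max_eq_left h0.le, div_eq_div_iff hpx.ne' hpy.ne'] at hω
      have h1 : tailMoment P X t x / tailMoment P X t y = (X ω - t) ^ (x - y) := by
        rw [Real.rpow_sub h0, div_eq_div_iff hpy.ne' (Real.rpow_pos_of_pos h0 _).ne']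
        linarith
      rw [h1, ← Real.rpow_mul h0.le, mul_one_div_cancel (sub_ne_zero.2 hxy), Real.rpow_one,
        sub_add_cancel]
  have h1 : ∫ ω in {ω | t < X ω}, ((max (X ω - t) 0) ^ x) ^ a * ((max (X ω - t) 0) ^ y) ^ (1 - a) ∂P
      = tailMoment P X t (a * x + b * y) := by
    refine integral_congr_ae ?_
    filter_upwards [hae] with ω hω
    rw [← Real.rpow_mul hω.le, ← Real.rpow_mul hω.le, ← Real.rpow_add hω, hb']
    congr 1
    ring
  rw [h1] at key
  change _ < tailMoment P X t x ^ a * tailMoment P X t y ^ (1 - a) at key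
  have h2 := Real.log_lt_log hpz key
  rw [Real.log_mul (Real.rpow_pos_of_pos hpx _).ne' (Real.rpow_pos_of_pos hpy _).ne',
    Real.log_rpow hpx, Real.log_rpow hpy, ← hb'] at h2
  simpa using h2

theorem log_lowerP (hα : 1 < α) (hX : X ∈ RVPow P α) (ht : (t : EReal) < xStar P X) :
    Real.log (lowerP P α X t) = α * Real.log (tailMoment P X t (α - 1)) -
      (α - 1) * Real.log (tailMoment P X t α) := by
  have h1 := posMoment_pos hX (sub_pos.2 hα).le (by linarith) ht
  have h2 := posMoment_pos hX (by linarith : 0 ≤ α) le_rfl ht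
  rw [lowerP_eq hα, Real.log_div (Real.rpow_pos_of_pos h1 _).ne' (Real.rpow_pos_of_pos h2 _).ne',
    Real.log_rpow h1, Real.log_rpow h2, tailMoment_eq (by linarith), tailMoment_eq (by linarith)]

theorem lowerP_lt_of_lt (hα : 1 < α) (hαβ : α < β) (hX : X ∈ RVPow P β)
    (ht : (t : EReal) < xStarStar P X) : lowerP P β X t < lowerP P α X t := by
  have ht' := ht.trans_le xStarStar_le_xStar
  have hX' := RVPow_anti (by linarith) hαβ.le hX
  have h := (strictConvexOn_log_tailMoment hX ht).intercept_lt hαβ hα.le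
  rw [← log_lowerP (by linarith) hX ht', ← log_lowerP hα hX' ht'] at h
  exact (Real.log_lt_log_iff (lowerP_pos (by linarith) hX ht') (lowerP_pos hα hX' ht')).1 h

/-- The chord over [0, 1] has intercept m(0) = log P(X > t), so this is the comparison of exponents
with lower exponent 1. -/
theorem lowerP_lt_real_gt (hα : 1 < α) (hX : X ∈ RVPow P α) (ht : (t : EReal) < xStarStar P X) :
    lowerP P α X t < P.real {ω | t < X ω} := by
  have ht' := ht.trans_le xStarStar_le_xStar
  have h := (strictConvexOn_log_tailMoment hX ht).intercept_lt hα le_rfl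
  rw [← log_lowerP hα hX ht', sub_self, one_mul, zero_mul, sub_zero, tailMoment_zero] at h
  exact (Real.log_lt_log_iff (lowerP_pos hα hX ht') (real_pos_of_lt_xStar hX.1 ht')).1 h

theorem lowerQ_lt_lowerQ (hα : 1 ≤ α) (hαβ : α < β) (hX : X ∈ RVPow P β)
    (hp : p ∈ Ioo (pStar P X) 1) : lowerQ P β X p < lowerQ P α X p := by
  have hp0 : 0 < p := pStar_nonneg.trans_lt hp.1
  have hX' := RVPow_anti (by linarith) hαβ.le hX
  obtain ⟨h1, h2⟩ := lowerQ_spec (by linarith) hX hp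
  by_contra! hle
  rcases hα.eq_or_lt with rfl | hα
  · have h3 := lowerP_lt_real_gt (by linarith) hX h1
    rw [h2] at h3
    rw [lowerQ_one hX' ⟨hp0, hp.2⟩] at hle
    exact (real_gt_le_of_quantileZero_le hX.1 hp0 hle).not_gt h3
  · have h3 := lowerP_lt_of_lt hα hαβ hX h1
    have h4 := lowerP_anti hα hX' hle (h1.trans_le xStarStar_le_xStar)
    rw [(lowerQ_spec hα hX' hp).2] at h4
    rw [h2] at h3
    exact h4.not_gt h3

theorem lowerQ_le_lowerQ (hα : 1 ≤ α) (hαβ : α < β) (hX : X ∈ RVPow P β)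
    (hp : p ∈ Ioo (0 : ℝ) 1) : lowerQ P β X p ≤ lowerQ P α X p := by
  rcases le_or_gt p (pStar P X) with h | h
  · have hX' := RVPow_anti (by linarith) hαβ.le hX
    exact (EReal.coe_eq_coe_iff.1 ((lowerQ_of_le_pStar (by linarith) hX hp.1 h).trans
      (lowerQ_of_le_pStar hα hX' hp.1 h).symm)).le
  · exact (lowerQ_lt_lowerQ hα hαβ hX ⟨h, hp.2⟩).le

theorem tendsto_lowerP_one (hα : 1 < α) (hX : X ∈ RVPow P α) (ht : (t : EReal) < xStar P X) :
    Tendsto (fun a : ℝ => lowerP P a X t) (𝓝[>] 1) (𝓝 (P.real {ω | t < X ω})) := by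
  have hα0 : 0 < α := by linarith
  have hbd : Integrable (fun ω => 1 + (max (X ω - t) 0) ^ α) P :=
    (integrable_const 1).add (integrable_max_sub_rpow hX hα0.le le_rfl t)
  have hle : ∀ y : ℝ, 0 ≤ y → ∀ r, 0 ≤ r → r ≤ α → y ^ r ≤ 1 + y ^ α := fun y hy r h0 h1 => by
    have hyα := Real.rpow_nonneg hy α
    rcases le_total y 1 with h | h
    · linarith [Real.rpow_le_one hy h h0]
    · linarith [Real.rpow_le_rpow_of_exponent_le h h1]
  -- Right limits only: at r0 = 0 the dominating function does not control negative exponents.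
  have hT : ∀ r0 : ℝ, 0 ≤ r0 → r0 < α → Tendsto (tailMoment P X t) (𝓝[≥] r0)
      (𝓝 (tailMoment P X t r0)) := by
    intro r0 h0 h1
    have hS : MeasurableSet {ω | t < X ω} := measurableSet_lt measurable_const hX.1
    refine tendsto_integral_filter_of_dominated_convergence
      (fun ω => 1 + (max (X ω - t) 0) ^ α)
      (Eventually.of_forall fun r => (measurable_max_sub_rpow hX.1 t r).aestronglyMeasurable)
      ?_ hbd.integrableOn ?_
    · filter_upwards [Icc_mem_nhdsGE h1] with r hr
      refine ae_of_all _ fun ω => ?_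
      rw [Real.norm_of_nonneg (max_rpow_nonneg _ _)]
      exact hle _ (le_max_right _ _) r (h0.trans hr.1) hr.2
    · filter_upwards [ae_restrict_mem hS] with ω hω
      have : 0 < max (X ω - t) 0 := lt_max_of_lt_left (sub_pos.2 hω)
      exact ((Real.continuous_const_rpow this.ne').tendsto r0).mono_left nhdsWithin_le_nhds
  have h1 : Tendsto (fun a : ℝ => tailMoment P X t (a - 1)) (𝓝[>] 1)
      (𝓝 (P.real {ω | t < X ω})) := by
    rw [← tailMoment_zero]
    refine (hT 0 le_rfl hα0).comp (tendsto_nhdsWithin_iff.2 ⟨?_, ?_⟩)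
    · have : Tendsto (fun a : ℝ => a - 1) (𝓝 1) (𝓝 (1 - 1)) :=
        (continuous_id.sub continuous_const).tendsto 1
      rw [sub_self] at this
      exact this.mono_left nhdsWithin_le_nhds
    · filter_upwards [self_mem_nhdsWithin] with a ha
      exact (sub_pos.2 (show (1 : ℝ) < a from ha)).le
  have h2 : Tendsto (tailMoment P X t) (𝓝[>] 1) (𝓝 (tailMoment P X t 1)) :=
    (hT 1 zero_le_one hα).mono_left (nhdsWithin_mono _ Ioi_subset_Ici_self)
  have hid : Tendsto (fun a : ℝ => a) (𝓝[>] 1) (𝓝 1) := nhdsWithin_le_nhds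
  have hid' : Tendsto (fun a : ℝ => a - 1) (𝓝[>] 1) (𝓝 0) := by
    simpa using hid.sub_const 1
  have hp0 := real_pos_of_lt_xStar hX.1 ht
  have hp1 := tailMoment_pos hX zero_le_one hα.le ht
  have h3 := (h1.rpow hid (Or.inl hp0.ne')).div (h2.rpow hid' (Or.inl hp1.ne'))
    (by rw [Real.rpow_zero]; exact one_ne_zero)
  rw [Real.rpow_one, Real.rpow_zero, div_one] at h3
  refine h3.congr' ?_
  filter_upwards [self_mem_nhdsWithin] with a ha
  have ha : 1 < a := ha
  rw [lowerP_eq ha, Pi.div_apply, tailMoment_eq (by linarith), tailMoment_eq (by linarith)]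

theorem RVPow_of_RVExp (hX : X ∈ RVExp P) (hα : 0 < α) : X ∈ RVPow P α := by
  obtain ⟨hm, l, hl, hi⟩ := hX
  refine ⟨hm, ((hi.const_mul ((α / l) ^ α))).mono'
    ((hm.max measurable_const).pow_const α).aestronglyMeasurable (ae_of_all _ fun ω => ?_)⟩
  rw [Real.norm_of_nonneg (max_rpow_nonneg _ _)]
  rcases le_total (X ω) 0 with h | h
  · rw [max_eq_right h, Real.zero_rpow hα.ne']
    positivity
  · rw [max_eq_left h]
    have h1 : X ω ≤ α / l * Real.exp (l * X ω / α) := by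
      have := Real.add_one_le_exp (l * X ω / α)
      have h2 : X ω = α / l * (l * X ω / α) := by field_simp
      calc X ω = α / l * (l * X ω / α) := h2
        _ ≤ _ := mul_le_mul_of_nonneg_left (by linarith) (by positivity)
    calc X ω ^ α ≤ (α / l * Real.exp (l * X ω / α)) ^ α := Real.rpow_le_rpow h h1 hα.le
      _ = _ := by
        rw [Real.mul_rpow (by positivity) (Real.exp_pos _).le, ← Real.exp_mul,
          div_mul_cancel₀ _ hα.ne']

/-- The point -α/l is chosen so that X + α/l = (α/l)(1 + lX/α) ≤ (α/l) e^{lX/α}, whose α-th power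
has the moment E e^{lX}. -/
theorem Bfun_le_exp (hX : Measurable X) {l : ℝ} (hl : 0 < l)
    (hi : Integrable (fun ω => Real.exp (l * X ω)) P) (hα : 0 < α) (hp : 0 < p) :
    Bfun P α X p (-(α / l)) ≤
      1 / l * (α * (((∫ ω, Real.exp (l * X ω) ∂P) / p) ^ (1 / α) - 1)) := by
  have hXα : X ∈ RVPow P α := RVPow_of_RVExp ⟨hX, l, hl, hi⟩ hα
  have h0 : 0 ≤ ∫ ω, Real.exp (l * X ω) ∂P := integral_nonneg fun ω => (Real.exp_pos _).le
  have h1 : posMoment P X α (-(α / l)) ≤ (α / l) ^ α * ∫ ω, Real.exp (l * X ω) ∂P := by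
    rw [posMoment, ← integral_const_mul]
    refine integral_mono (integrable_max_sub_rpow hXα hα.le le_rfl _) (hi.const_mul _) fun ω => ?_
    have h2 : max (X ω - -(α / l)) 0 ≤ α / l * Real.exp (l * X ω / α) := by
      refine max_le ?_ (by positivity)
      have := Real.add_one_le_exp (l * X ω / α)
      have h2 : X ω - -(α / l) = α / l * (l * X ω / α + 1) := by
        field_simp
        ring
      rw [h2]
      exact mul_le_mul_of_nonneg_left this (by positivity)
    calc (max (X ω - -(α / l)) 0) ^ α ≤ (α / l * Real.exp (l * X ω / α)) ^ α :=
          Real.rpow_le_rpow (le_max_right _ _) h2 hα.le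
      _ = _ := by
        rw [Real.mul_rpow (by positivity) (Real.exp_pos _).le, ← Real.exp_mul,
          div_mul_cancel₀ _ hα.ne']
  have h2 : posNorm P X α (-(α / l)) ≤ α / l * (∫ ω, Real.exp (l * X ω) ∂P) ^ (1 / α) := by
    refine (Real.rpow_le_rpow posMoment_nonneg h1 (by positivity)).trans (le_of_eq ?_)
    rw [Real.mul_rpow (by positivity) h0, ← Real.rpow_mul (by positivity),
      mul_one_div_cancel hα.ne', Real.rpow_one]
  have hpp : 0 < p ^ (1 / α) := Real.rpow_pos_of_pos hp _
  have h3 := div_le_div_of_nonneg_right h2 hpp.le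
  rw [Bfun_eq, Real.div_rpow h0 hp.le]
  refine (add_le_add_right h3 _).trans (le_of_eq ?_)
  field_simp
  ring

theorem tendsto_mul_rpow_inv_sub_one {c : ℝ} (hc : 0 < c) :
    Tendsto (fun a : ℝ => a * (c ^ (1 / a) - 1)) atTop (𝓝 (Real.log c)) := by
  have h := (Real.hasStrictDerivAt_const_rpow hc 0).hasDerivAt.tendsto_slope_zero_right
  rw [Real.rpow_zero, one_mul] at h
  refine (h.comp tendsto_inv_atTop_nhdsGT_zero).congr fun a => ?_
  simp

/-- If `p > p_*`, then `λ⁻¹ log (E e^{λX} / p) < x_*` for some `λ`. -/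
theorem exists_log_mgf_lt (hX : X ∈ RVExp P) (hp : p ∈ Ioo (pStar P X) 1) :
    ∃ l : ℝ, 0 < l ∧ Integrable (fun ω => Real.exp (l * X ω)) P ∧
      ((1 / l * Real.log ((∫ ω, Real.exp (l * X ω) ∂P) / p) : ℝ) : EReal) < xStar P X := by
  obtain ⟨hm, l, hl, hi⟩ := hX
  have hp0 : 0 < p := pStar_nonneg.trans_lt hp.1
  by_cases htop : xStar P X = ⊤
  · exact ⟨l, hl, hi, htop ▸ EReal.coe_lt_top _⟩
  obtain ⟨x, hx⟩ := exists_xStar_eq_coe hm htop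
  have hle := ae_le_of_xStar_le hm hx.le
  -- For finite x = x_*, E e^{l(X-x)} tends to p_* < p as l → ∞, so a large l works.
  have hlim : Tendsto (fun l : ℝ => ∫ ω, Real.exp (l * (X ω - x)) ∂P) atTop
      (𝓝 (∫ ω, {ω | X ω = x}.indicator (fun _ => (1 : ℝ)) ω ∂P)) := by
    refine tendsto_integral_filter_of_dominated_convergence (fun _ => 1)
      (Eventually.of_forall fun l =>
        (((hm.sub_const x).const_mul l).exp).aestronglyMeasurable) ?_ (integrable_const _) ?_
    · filter_upwards [eventually_ge_atTop 0] with l hl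
      filter_upwards [hle] with ω hω
      rw [Real.norm_of_nonneg (Real.exp_pos _).le]
      exact Real.exp_le_one_iff.2 (mul_nonpos_of_nonneg_of_nonpos hl (sub_nonpos.2 hω))
    · filter_upwards [hle] with ω hω
      rcases hω.eq_or_lt with h | h
      · rw [indicator_of_mem (show ω ∈ {ω | X ω = x} from h), h]
        simp
      · rw [indicator_of_notMem (show ω ∉ {ω | X ω = x} from h.ne)]
        exact Real.tendsto_exp_atBot.comp
          (tendsto_id.atTop_mul_const_of_neg (sub_neg.2 h))
  have hpx : ∫ ω, {ω | X ω = x}.indicator (fun _ => (1 : ℝ)) ω ∂P = pStar P X := by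
    have hS : MeasurableSet {ω | X ω = x} := hm (measurableSet_singleton x)
    rw [integral_indicator hS, setIntegral_const, smul_eq_mul,
      mul_one, pStar, hx]
    simp only [EReal.coe_eq_coe_iff]
  rw [hpx] at hlim
  obtain ⟨l, hlp, hl⟩ := ((hlim.eventually_lt_const hp.1).and (eventually_gt_atTop 0)).exists
  have hi' : Integrable (fun ω => Real.exp (l * X ω)) P := by
    refine Integrable.mono' (integrable_const (Real.exp (l * x)))
      ((hm.const_mul l).exp).aestronglyMeasurable ?_
    filter_upwards [hle] with ω hω
    rw [Real.norm_of_nonneg (Real.exp_pos _).le]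
    exact Real.exp_le_exp.2 (mul_le_mul_of_nonneg_left hω hl.le)
  refine ⟨l, hl, hi', ?_⟩
  rw [hx, EReal.coe_lt_coe_iff, one_div_mul_eq_div, div_lt_iff₀ hl]
  have h1 : ∫ ω, Real.exp (l * X ω) ∂P = Real.exp (l * x) * ∫ ω, Real.exp (l * (X ω - x)) ∂P := by
    rw [← integral_const_mul]
    congr 1 with ω
    rw [← Real.exp_add]
    congr 1
    ring
  rw [Real.log_lt_iff_lt_exp (div_pos (integral_exp_pos hi') hp0), div_lt_iff₀ hp0, h1,
    mul_comm x l]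
  exact mul_lt_mul_of_pos_left hlp (Real.exp_pos _)

theorem tendsto_lowerQ_atBot (hX : X ∈ RVExp P) (hp : p ∈ Ioo (pStar P X) 1) :
    Tendsto (fun α : ℝ => lowerQ P α X p) atTop atBot := by
  have hp0 : 0 < p := pStar_nonneg.trans_lt hp.1
  obtain ⟨l, hl, hi, hlt⟩ := exists_log_mgf_lt hX hp
  set L := 1 / l * Real.log ((∫ ω, Real.exp (l * X ω) ∂P) / p)
  obtain ⟨x, hLx, hx⟩ := EReal.lt_iff_exists_real_btwn.1 hlt
  have hLx := EReal.coe_lt_coe_iff.1 hLx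
  refine tendsto_atBot.2 fun M => ?_
  set t := min M x
  -- Capping the ratio at 1 makes τ + (x-τ) q^{1/a} nondecreasing in τ, so its value at t bounds B
  -- from below for t < τ ≤ x.
  have hq0 : 0 < min (tailProb P X x / p) 1 := by
    refine lt_min (div_pos ((real_pos_of_lt_xStar hX.1 hx).trans_le ?_) hp0) one_pos
    exact measureReal_mono fun ω hω => (show x < X ω from hω).le
  set q := min (tailProb P X x / p) 1
  have hinv : Tendsto (fun a : ℝ => 1 / a) atTop (𝓝 0) := by
    simpa using tendsto_inv_atTop_zero
  have hlow : Tendsto (fun a : ℝ => t + (x - t) * q ^ (1 / a)) atTop (𝓝 x) := by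
    have := ((((Real.continuous_const_rpow hq0.ne').tendsto 0).comp hinv).const_mul
      (x - t)).const_add t
    simpa using this
  have hup : Tendsto (fun a : ℝ =>
      1 / l * (a * (((∫ ω, Real.exp (l * X ω) ∂P) / p) ^ (1 / a) - 1))) atTop (𝓝 L) :=
    (tendsto_mul_rpow_inv_sub_one (div_pos (integral_exp_pos hi) hp0)).const_mul _
  filter_upwards [hup.eventually_lt hlow hLx, eventually_ge_atTop 1] with a ha ha1
  have ha0 : 0 < a := by linarith
  have hXa := RVPow_of_RVExp hX ha0
  have hmin := (isGreatest_lowerQ ha1 hXa ⟨hp0, hp.2⟩).1 (-(a / l))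
  have hB := (hmin.trans (Bfun_le_exp hX.1 hl hi ha0 hp0)).trans_lt ha
  set τ := lowerQ P a X p
  by_contra! hM
  have htτ : t < τ := (min_le_left _ _).trans_lt hM
  have htx : t ≤ x := min_le_right _ _
  have hq1 : q ^ (1 / a) ≤ 1 := Real.rpow_le_one hq0.le (min_le_right _ _) (by positivity)
  rcases le_total τ x with h | h
  · have h1 := add_mul_le_Bfun hXa ha0 hp0 h
    have h2 : q ^ (1 / a) ≤ (tailProb P X x / p) ^ (1 / a) :=
      Real.rpow_le_rpow hq0.le (min_le_left _ _) (by positivity)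
    nlinarith [mul_le_mul_of_nonneg_left h2 (sub_nonneg.2 h),
      mul_nonneg (sub_nonneg.2 htτ.le) (sub_nonneg.2 hq1)]
  · have h1 := le_Bfun (P := P) (X := X) (α := a) (t := τ) hp0
    nlinarith [mul_nonneg (sub_nonneg.2 htx) (sub_nonneg.2 hq1)]

end Exponent

/-! ### Strict monotonicity, continuity and limits in p -/

section DependenceOnP

variable {Ω : Type*} [MeasurableSpace Ω] {P : Measure Ω} [IsProbabilityMeasure P] {X : Ω → ℝ}
  {α t p q : ℝ}

theorem strictAntiOn_lowerQ (hα : 1 < α) (hX : X ∈ RVPow P α) :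
    StrictAntiOn (fun p : ℝ => lowerQ P α X p) (Ico (pStar P X) 1 ∩ Ioo 0 1) := by
  intro p hp q hq hpq
  have hq' : q ∈ Ioo (pStar P X) 1 := ⟨hp.1.1.trans_lt hpq, hq.1.2⟩
  obtain ⟨h1, h2⟩ := lowerQ_spec hα hX hq'
  have hqx := h1.trans_le xStarStar_le_xStar
  rcases hp.1.1.eq_or_lt with h | h
  · have := lowerQ_of_le_pStar hα.le hX hp.2.1 h.ge
    exact EReal.coe_lt_coe_iff.1 (hqx.trans_eq this.symm)
  · exact (lt_lowerQ_iff hα hX ⟨h, hp.1.2⟩ hqx).2 (hpq.trans_eq h2.symm)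

theorem continuousOn_lowerQ (hα : 1 < α) (hX : X ∈ RVPow P α) :
    ContinuousOn (fun p : ℝ => lowerQ P α X p) (Ioo (pStar P X) 1) := by
  intro p hp
  have hnhds : Ioo (pStar P X) 1 ∈ 𝓝 p := isOpen_Ioo.mem_nhds hp
  have hx := (lowerQ_spec hα hX hp).1.trans_le xStarStar_le_xStar
  refine ContinuousAt.continuousWithinAt (tendsto_order.2 ⟨fun a ha => ?_, fun b hb => ?_⟩)
  · have hax := (EReal.coe_lt_coe_iff.2 ha).trans hx
    filter_upwards [hnhds, gt_mem_nhds ((lt_lowerQ_iff hα hX hp hax).1 ha)] with q hq hqa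
    exact (lt_lowerQ_iff hα hX hq hax).2 hqa
  · obtain ⟨u, hu, hux⟩ := EReal.lt_iff_exists_real_btwn.1
      (lt_min hx (EReal.coe_lt_coe_iff.2 hb))
    have hub := EReal.coe_lt_coe_iff.1 (hux.trans_le (min_le_right _ _))
    have hux := hux.trans_le (min_le_left _ _)
    have hu := EReal.coe_lt_coe_iff.1 hu
    filter_upwards [hnhds, lt_mem_nhds ((lowerQ_lt_iff hα hX hp hux).1 hu)] with q hq hqu
    exact ((lowerQ_lt_iff hα hX hq hux).2 hqu).trans hub

theorem tendsto_lowerQ_pStar (hα : 1 < α) (hX : X ∈ RVPow P α) (h1 : pStar P X < 1) :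
    Tendsto (fun p : ℝ => (lowerQ P α X p : EReal)) (𝓝[>] (pStar P X)) (𝓝 (xStarStar P X)) := by
  have hmem : Ioo (pStar P X) 1 ∈ 𝓝[>] (pStar P X) := Ioo_mem_nhdsGT h1
  refine tendsto_order.2 ⟨fun a ha => ?_, fun b hb => ?_⟩
  · obtain ⟨u, hau, hu⟩ := EReal.lt_iff_exists_real_btwn.1 ha
    filter_upwards [hmem, Ioo_mem_nhdsGT (pStar_lt_lowerP hα hX hu)] with q hq hqu
    exact hau.trans (EReal.coe_lt_coe_iff.2
      ((lt_lowerQ_iff hα hX hq (hu.trans_le xStarStar_le_xStar)).2 hqu.2))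
  · filter_upwards [hmem] with q hq
    exact (lowerQ_spec hα hX hq).1.trans hb

theorem tendsto_lowerQ_one (hα : 1 < α) (hX : X ∈ RVPow P α) (h1 : pStar P X < 1) :
    Tendsto (fun p : ℝ => lowerQ P α X p) (𝓝[<] 1) atBot := by
  obtain ⟨p, hp⟩ := exists_between h1
  have hx := (lowerQ_spec hα hX hp).1
  refine tendsto_atBot.2 fun b => ?_
  set u := min b (lowerQ P α X p)
  have hu : (u : EReal) < xStarStar P X := (EReal.coe_le_coe_iff.2 (min_le_right _ _)).trans_lt hx
  -- Strictness matters: P(u) < 1 leaves room for p between P(u) and 1.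
  have hlt := (lowerP_lt_real_gt hα hX hu).trans_le measureReal_le_one
  filter_upwards [Ioo_mem_nhdsLT h1, Ioo_mem_nhdsLT hlt] with q hq hqu
  exact ((lowerQ_lt_iff hα hX hq (hu.trans_le xStarStar_le_xStar)).2 hqu.1).le.trans
    (min_le_left _ _)

end DependenceOnP

/-! ### Constants, scaling, translation and upper bounds -/

section Transformations

variable {Ω : Type*} [MeasurableSpace Ω] {P : Measure Ω} [IsProbabilityMeasure P] {X : Ω → ℝ}
  {α t p q : ℝ}

theorem mem_RVPow_of_le (hX : Measurable X) {c : ℝ} (h : ∀ ω, X ω ≤ c) (hα : 0 < α) :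
    X ∈ RVPow P α := by
  refine ⟨hX, Integrable.mono' (integrable_const ((max c 0) ^ α))
    ((hX.max measurable_const).pow_const α).aestronglyMeasurable (ae_of_all _ fun ω => ?_)⟩
  rw [Real.norm_of_nonneg (max_rpow_nonneg _ _)]
  exact Real.rpow_le_rpow (le_max_right _ _) (max_le_max (h ω) le_rfl) hα.le

theorem lowerQ_const (hα : 1 ≤ α) (hp : p ∈ Ioo (0 : ℝ) 1) (c : ℝ) :
    lowerQ P α (fun _ => c) p = c := by
  refine lowerQ_eq_of_isGreatest (isGreatest_argminB_of_le_atom hα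
    (mem_RVPow_of_le measurable_const (fun _ => le_rfl) (by linarith)) hp.1
    (ae_of_all _ fun _ => le_rfl) ?_)
  simpa using hp.2.le

theorem Bfun_mul (hα : 0 < α) {k : ℝ} (hk : 0 < k) (X : Ω → ℝ) (p t : ℝ) :
    Bfun P α (fun ω => k * X ω) p (k * t) = k * Bfun P α X p t := by
  have h1 : posMoment P (fun ω => k * X ω) α (k * t) = k ^ α * posMoment P X α t := by
    rw [posMoment, posMoment, ← integral_const_mul]
    congr 1 with ω
    rw [← Real.mul_rpow hk.le (le_max_right _ _), ← mul_sub, mul_max_of_nonneg _ _ hk.le, mul_zero]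
  rw [Bfun_eq, Bfun_eq, posNorm, posNorm, h1, Real.mul_rpow (by positivity) posMoment_nonneg,
    ← Real.rpow_mul hk.le, mul_one_div_cancel hα.ne', Real.rpow_one]
  ring

theorem lowerQ_mul (hα : 1 ≤ α) (hX : X ∈ RVPow P α) (hp : p ∈ Ioo (0 : ℝ) 1) {k : ℝ}
    (hk : 0 ≤ k) : lowerQ P α (fun ω => k * X ω) p = k * lowerQ P α X p := by
  rcases hk.eq_or_lt with rfl | hk
  · simp only [zero_mul]
    exact lowerQ_const hα hp 0
  have hα0 : 0 < α := by linarith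
  have h := isGreatest_lowerQ hα hX hp
  have hB : ∀ s, Bfun P α (fun ω => k * X ω) p s = k * Bfun P α X p (s / k) := fun s => by
    rw [← Bfun_mul hα0 hk, mul_div_cancel₀ _ hk.ne']
  refine lowerQ_eq_of_isGreatest ⟨fun s => ?_, fun s hs => ?_⟩
  · rw [Bfun_mul hα0 hk, hB s]
    exact mul_le_mul_of_nonneg_left (h.1 _) hk.le
  · rw [← div_le_iff₀' hk]
    refine h.2 fun u => ?_
    have := hs (k * u)
    rw [Bfun_mul hα0 hk, hB s] at this
    exact le_of_mul_le_mul_left this hk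

theorem Bfun_add (X : Ω → ℝ) (p c s : ℝ) :
    Bfun P α (fun ω => X ω + c) p s = Bfun P α X p (s - c) + c := by
  have h1 : posMoment P (fun ω => X ω + c) α s = posMoment P X α (s - c) := by
    rw [posMoment, posMoment]
    congr 1 with ω
    rw [sub_sub_eq_add_sub]
  rw [Bfun_eq, Bfun_eq, posNorm, posNorm, h1]
  ring

theorem lowerQ_add (hα : 1 ≤ α) (hX : X ∈ RVPow P α) (hp : p ∈ Ioo (0 : ℝ) 1) (c : ℝ) :
    lowerQ P α (fun ω => X ω + c) p = lowerQ P α X p + c := by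
  have h := isGreatest_lowerQ hα hX hp
  refine lowerQ_eq_of_isGreatest ⟨fun s => ?_, fun s hs => ?_⟩
  · rw [Bfun_add, Bfun_add, add_sub_cancel_right]
    exact add_le_add_left (h.1 _) c
  · rw [← sub_le_iff_le_add]
    refine h.2 fun u => ?_
    have := hs (u + c)
    rw [Bfun_add, Bfun_add, add_sub_cancel_right] at this
    exact le_of_add_le_add_right this

/-- For the minimizer τ, τ ≤ B(τ) ≤ B(c) = c. -/
theorem lowerQ_le_of_ae_le (hα : 1 ≤ α) (hX : X ∈ RVPow P α) (hp : p ∈ Ioo (0 : ℝ) 1) {c : ℝ}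
    (h : ∀ᵐ ω ∂P, X ω ≤ c) : lowerQ P α X p ≤ c := by
  have hα0 : α ≠ 0 := by linarith
  exact (le_Bfun hp.1).trans (((isGreatest_lowerQ hα hX hp).1 c).trans_eq (Bfun_eq_self hα0 h))

end Transformations

/-! ### The conditional form of `lowerP` -/

section CondExpression

variable {Ω : Type*} [MeasurableSpace Ω] {P : Measure Ω} [IsProbabilityMeasure P] {X : Ω → ℝ}
  {α r t : ℝ}

theorem integral_cond_sub_rpow (hX : Measurable X) (hr : r ≠ 0) :
    ∫ ω, (X ω - t) ^ r ∂(ProbabilityTheory.cond P {ω | t < X ω}) =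
      (P.real {ω | t < X ω})⁻¹ * posMoment P X r t := by
  have hS : MeasurableSet {ω | t < X ω} := measurableSet_lt measurable_const hX
  rw [ProbabilityTheory.cond, integral_smul_measure, smul_eq_mul, ENNReal.toReal_inv,
    ← tailMoment_eq hr]
  congr 1
  refine setIntegral_congr_fun hS fun ω hω => ?_
  rw [max_eq_left (sub_pos.2 hω).le]

theorem lowerP_eq_cond (hα : 1 < α) (hX : X ∈ RVPow P α) (ht : (t : EReal) < xStar P X) :
    lowerP P α X t = P.real {ω | t < X ω} *
      ((∫ ω, (X ω - t) ^ (α - 1) ∂(ProbabilityTheory.cond P {ω | t < X ω})) ^ α /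
        (∫ ω, (X ω - t) ^ α ∂(ProbabilityTheory.cond P {ω | t < X ω})) ^ (α - 1)) := by
  have hq := real_pos_of_lt_xStar hX.1 ht
  set q := P.real {ω | t < X ω} with hqdef
  rw [integral_cond_sub_rpow hX.1 (by linarith), integral_cond_sub_rpow hX.1 (by linarith),
    ← hqdef, lowerP_eq hα, Real.mul_rpow (inv_nonneg.2 hq.le) posMoment_nonneg,
    Real.mul_rpow (inv_nonneg.2 hq.le) posMoment_nonneg, mul_div_mul_comm,
    ← Real.rpow_sub (inv_pos.2 hq), sub_sub_cancel, Real.rpow_one, ← mul_assoc,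
    mul_inv_cancel₀ hq.ne', one_mul]

end CondExpression

/-! ### Indicators against monotonicity, subadditivity and convexity -/

section Counterexamples

variable {Ω : Type*} [MeasurableSpace Ω] {P : Measure Ω} [IsProbabilityMeasure P]
  {α p q : ℝ} {A : Set Ω}

theorem indicator_one_le (ω : Ω) : A.indicator (fun _ => (1 : ℝ)) ω ≤ 1 := by
  by_cases h : ω ∈ A <;> simp [h]

theorem setOf_indicator_one_eq (A : Set Ω) : {ω | A.indicator (fun _ => (1 : ℝ)) ω = 1} = A := by
  ext ω
  by_cases h : ω ∈ A <;> simp [h]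

theorem indicator_one_mem_RVPow (hA : MeasurableSet A) (hα : 0 < α) :
    A.indicator (fun _ => (1 : ℝ)) ∈ RVPow P α :=
  mem_RVPow_of_le (measurable_const.indicator hA) indicator_one_le hα

theorem lowerQ_indicator_eq_one (hA : MeasurableSet A) (hα : 1 ≤ α) (hp : 0 < p)
    (hpA : p ≤ P.real A) : lowerQ P α (A.indicator fun _ => (1 : ℝ)) p = 1 :=
  lowerQ_eq_of_isGreatest (isGreatest_argminB_of_le_atom hα
    (indicator_one_mem_RVPow hA (by linarith)) hp (ae_of_all _ indicator_one_le)
    (by rwa [setOf_indicator_one_eq]))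

theorem lowerQ_one_indicator_le (hA : MeasurableSet A) (hp : p ∈ Ioo (0 : ℝ) 1)
    (hpA : P.real A < p) : lowerQ P 1 (A.indicator fun _ => (1 : ℝ)) p ≤ 0 := by
  rw [lowerQ_one (indicator_one_mem_RVPow hA one_pos) hp]
  by_contra! hlt
  have h1 := le_tailProb_of_lt_quantileZero hp.2 (half_lt_self hlt)
  refine (h1.trans (measureReal_mono fun ω hω => ?_)).not_gt hpA
  by_contra hn
  change _ ≤ A.indicator (fun _ => (1 : ℝ)) ω at hω
  rw [indicator_of_notMem hn] at hω
  linarith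

theorem lowerQ_indicator_le (hA : MeasurableSet A) (hα : 1 ≤ α) (hp : p ∈ Ioo (0 : ℝ) 1)
    (hpA : P.real A < p) : lowerQ P α (A.indicator fun _ => (1 : ℝ)) p ≤ 0 := by
  rcases hα.eq_or_lt with rfl | hα
  · exact lowerQ_one_indicator_le hA hp hpA
  · exact (lowerQ_le_lowerQ le_rfl hα (indicator_one_mem_RVPow hA (by linarith)) hp).trans
      (lowerQ_one_indicator_le hA hp hpA)

/-- Here p_* is the probability of A, which is below p, so the strict decrease in α applies,
starting from a value at most 0 at α = 1. -/
theorem lowerQ_indicator_neg (hA : MeasurableSet A) (hα : 1 < α) (hp : p ∈ Ioo (0 : ℝ) 1)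
    (hA0 : 0 < P.real A) (hpA : P.real A < p) :
    lowerQ P α (A.indicator fun _ => (1 : ℝ)) p < 0 := by
  have h := (xStar_eq_of_ae_le (P := P) (X := A.indicator fun _ => (1 : ℝ))
    (measurable_const.indicator hA) (c := 1)
    (ae_of_all _ (indicator_one_le (A := A))) (by rwa [setOf_indicator_one_eq])).2
  rw [setOf_indicator_one_eq] at h
  exact (lowerQ_lt_lowerQ le_rfl hα (indicator_one_mem_RVPow hA (by linarith))
    (mem_Ioo.2 ⟨h.trans_lt hpA, hp.2⟩)).trans_le (lowerQ_one_indicator_le hA hp hpA)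

theorem CarriesUniform.exists_partition (h : CarriesUniform P) (hp : p ∈ Ioo (0 : ℝ) 1) :
    ∃ A B : Set Ω, MeasurableSet A ∧ MeasurableSet B ∧ Disjoint A B ∧
      P.real A = p / 2 ∧ P.real B = p / 2 := by
  obtain ⟨U, hU, hUmap⟩ := h
  have key : ∀ a b : ℝ, 0 ≤ a → a ≤ b → b ≤ 1 → P.real (U ⁻¹' Ico a b) = b - a := by
    intro a b ha hab hb
    rw [← map_measureReal_apply hU measurableSet_Ico, hUmap,
      measureReal_restrict_apply measurableSet_Ico,
      inter_eq_self_of_subset_left (Ico_subset_Icc_self.trans (Icc_subset_Icc ha hb)),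
      Real.volume_real_Ico_of_le hab]
  obtain ⟨h0, h1⟩ := hp
  refine ⟨U ⁻¹' Ico 0 (p / 2), U ⁻¹' Ico (p / 2) p, hU measurableSet_Ico, hU measurableSet_Ico,
    ?_, ?_, ?_⟩
  · refine Disjoint.preimage _ (Set.disjoint_left.2 fun x hx hx' => ?_)
    exact hx'.1.not_gt hx.2
  · rw [key _ _ le_rfl (by linarith) (by linarith), sub_zero]
  · rw [key _ _ (by linarith) (by linarith) h1.le]
    ring

theorem not_monotoneOn_lowerQ (h : CarriesUniform P) (hα : 1 < α) (hp : p ∈ Ioo (0 : ℝ) 1) :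
    ¬ MonotoneOn (fun X : Ω → ℝ => lowerQ P α X p) (RVPow P α) := by
  obtain ⟨A, -, hA, -, -, hpA, -⟩ := h.exists_partition hp
  obtain ⟨h0, h1⟩ := hp
  intro hmono
  have h2 := hmono (mem_RVPow_of_le (c := 0) measurable_const (fun _ => le_rfl) (by linarith))
    (indicator_one_mem_RVPow hA (by linarith)) (a := fun _ => 0)
    fun ω => indicator_nonneg (fun _ _ => zero_le_one) ω
  simp only at h2
  rw [lowerQ_const hα.le ⟨h0, h1⟩] at h2
  exact h2.not_gt (lowerQ_indicator_neg hA hα ⟨h0, h1⟩ (by linarith) (by linarith))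

theorem not_antitoneOn_lowerQ (hα : 1 ≤ α) (hp : p ∈ Ioo (0 : ℝ) 1) :
    ¬ AntitoneOn (fun X : Ω → ℝ => lowerQ P α X p) (RVPow P α) := by
  intro hanti
  have hc : ∀ c : ℝ, (fun _ => c) ∈ RVPow P α := fun c =>
    mem_RVPow_of_le measurable_const (fun _ => le_rfl) (by linarith)
  have h2 := hanti (hc 0) (hc 1) fun _ => zero_le_one
  simp only [lowerQ_const hα hp] at h2
  linarith

theorem exists_lowerQ_add_gt (h : CarriesUniform P) (hα : 1 ≤ α) (hp : p ∈ Ioo (0 : ℝ) 1) :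
    ∃ X ∈ RVPow P α, ∃ Y ∈ RVPow P α, (fun ω => X ω + Y ω) ∈ RVPow P α ∧
      lowerQ P α X p + lowerQ P α Y p < lowerQ P α (fun ω => X ω + Y ω) p := by
  obtain ⟨A, B, hA, hB, hAB, hpA, hpB⟩ := h.exists_partition hp
  have hα0 : 0 < α := by linarith
  have hadd : (fun ω => A.indicator (fun _ => (1 : ℝ)) ω + B.indicator (fun _ => (1 : ℝ)) ω) =
      (A ∪ B).indicator fun _ => (1 : ℝ) := (indicator_union_of_disjoint hAB _).symm
  refine ⟨_, indicator_one_mem_RVPow hA hα0, _, indicator_one_mem_RVPow hB hα0, ?_, ?_⟩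
  · rw [hadd]
    exact indicator_one_mem_RVPow (hA.union hB) hα0
  · have hU : P.real (A ∪ B) = p := by
      rw [measureReal_union hAB hB, hpA, hpB]
      ring
    rw [hadd, lowerQ_indicator_eq_one (hA.union hB) hα hp.1 hU.ge]
    have h1 := lowerQ_indicator_le hA hα hp (by linarith [hp.1])
    have h2 := lowerQ_indicator_le hB hα hp (by linarith [hp.1])
    linarith

end Counterexamples

theorem mainTheorem7 {Ω : Type*} [MeasurableSpace Ω] (P : Measure Ω) [IsProbabilityMeasure P] :
    -- the largest minimizer exists, so that `lowerQ` is well defined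
    (∀ α : ℝ, 1 ≤ α → ∀ X ∈ RVPow P α, ∀ p ∈ Ioo (0 : ℝ) 1,
      IsGreatest (argminB P α X p) (lowerQ P α X p)) ∧
    -- the value for `p ≤ p_*`
    (∀ α : ℝ, 1 ≤ α → ∀ X ∈ RVPow P α, ∀ p ∈ Ioo (0 : ℝ) 1, p ≤ pStar P X →
      (lowerQ P α X p : EReal) = xStar P X ∧ lowerQ P α X p = quantileZero P X p) ∧
    -- the case `p > p_*`: the value is the only root `t ∈ (-∞, x_*)` of the equation `_{α-1}P(X;t) = p`,
    -- and it lies in `(-∞, x_**)`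
    (∀ α : ℝ, 1 < α → ∀ X ∈ RVPow P α, ∀ p ∈ Ioo (pStar P X) 1,
      (∃! t : ℝ, (t : EReal) < xStar P X ∧ lowerP P α X t = p) ∧
      (lowerQ P α X p : EReal) < xStar P X ∧
      lowerP P α X (lowerQ P α X p) = p ∧
      (lowerQ P α X p : EReal) < xStarStar P X) ∧
    -- the other two expressions for `_{α-1}P(X;t)`
    (∀ α : ℝ, 1 < α → ∀ X ∈ RVPow P α, ∀ t : ℝ, (t : EReal) < xStar P X →
      lowerP P α X t = (∫ ω, (max (X ω - t) 0) ^ (α - 1) ∂P) ^ α /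
          (∫ ω, (max (X ω - t) 0) ^ α ∂P) ^ (α - 1) ∧
      lowerP P α X t = P.real {ω | t < X ω} *
          ((∫ ω, (X ω - t) ^ (α - 1) ∂(ProbabilityTheory.cond P {ω | t < X ω})) ^ α /
            (∫ ω, (X ω - t) ^ α ∂(ProbabilityTheory.cond P {ω | t < X ω})) ^ (α - 1))) ∧
    -- comparison of `_{α-1}P(X;t)` with tail probabilities
    (∀ α : ℝ, 1 < α → ∀ X ∈ RVPow P α, ∀ t : ℝ, (t : EReal) < xStar P X →
      lowerP P α X t ≤ P.real {ω | t < X ω} ∧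
      P.real {ω | t < X ω} ≤ tailProb P X t ∧
      Tendsto (fun a : ℝ => lowerP P a X t) (𝓝[>] 1) (𝓝 (P.real {ω | t < X ω}))) ∧
    (∀ α : ℝ, 1 < α → ∀ X ∈ RVPow P α, ∀ t : ℝ, (t : EReal) < xStarStar P X →
      lowerP P α X t < P.real {ω | t < X ω}) ∧
    -- dependence on `p`
    (∀ α : ℝ, 1 ≤ α → ∀ X ∈ RVPow P α,
      AntitoneOn (fun p : ℝ => lowerQ P α X p) (Ioo 0 1) ∧
      ∀ p ∈ Ioc 0 (pStar P X) ∩ Ioo (0 : ℝ) 1, (lowerQ P α X p : EReal) = xStar P X) ∧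
    (∀ α : ℝ, 1 < α → ∀ X ∈ RVPow P α,
      StrictAntiOn (fun p : ℝ => lowerQ P α X p) (Ico (pStar P X) 1 ∩ Ioo 0 1) ∧
      ContinuousOn (fun p : ℝ => lowerQ P α X p) (Ioo (pStar P X) 1) ∧
      (pStar P X < 1 →
        Tendsto (fun p : ℝ => (lowerQ P α X p : EReal)) (𝓝[>] (pStar P X))
          (𝓝 (xStarStar P X)) ∧
        Tendsto (fun p : ℝ => lowerQ P α X p) (𝓝[<] 1) atBot)) ∧
    -- dependence on `α`
    (∀ α β : ℝ, 1 ≤ α → α < β → ∀ X ∈ RVPow P β, ∀ p ∈ Ioo (0 : ℝ) 1,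
      lowerQ P β X p ≤ lowerQ P α X p) ∧
    (∀ α : ℝ, 1 ≤ α → ∀ X ∈ RVPow P α, ∀ p ∈ Ioo (0 : ℝ) 1,
      lowerQ P α X p ≤ lowerQ P 1 X p ∧ lowerQ P 1 X p = quantileZero P X p) ∧
    (∀ α β : ℝ, 1 ≤ α → α < β → ∀ X ∈ RVPow P β, ∀ p ∈ Ioo (pStar P X) 1,
      lowerQ P β X p < lowerQ P α X p) ∧
    (∀ X ∈ RVExp P, ∀ p ∈ Ioo (pStar P X) 1,
      Tendsto (fun α : ℝ => lowerQ P α X p) atTop atBot) ∧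
    -- consistency
    (∀ α : ℝ, 1 ≤ α → ∀ p ∈ Ioo (0 : ℝ) 1, ∀ c : ℝ, lowerQ P α (fun _ => c) p = c) ∧
    -- positive homogeneity
    (∀ α : ℝ, 1 ≤ α → ∀ X ∈ RVPow P α, ∀ p ∈ Ioo (0 : ℝ) 1, ∀ κ : ℝ, 0 ≤ κ →
      lowerQ P α (fun ω => κ * X ω) p = κ * lowerQ P α X p) ∧
    -- translation invariance
    (∀ α : ℝ, 1 ≤ α → ∀ X ∈ RVPow P α, ∀ p ∈ Ioo (0 : ℝ) 1, ∀ c : ℝ,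
      lowerQ P α (fun ω => X ω + c) p = lowerQ P α X p + c) ∧
    -- partial monotonicity
    (∀ α : ℝ, 1 ≤ α → ∀ X ∈ RVPow P α, ∀ p ∈ Ioo (0 : ℝ) 1, ∀ c : ℝ,
      ((∀ᵐ ω ∂P, X ω ≤ c) → lowerQ P α X p ≤ lowerQ P α (fun _ => c) p) ∧
      (0 ≤ c → lowerQ P α X p ≤ lowerQ P α (fun ω => X ω + c) p)) ∧
    -- no monotonicity, in either direction, on a space that is rich enough
    (CarriesUniform P → ∀ α : ℝ, 1 < α → ∀ p ∈ Ioo (0 : ℝ) 1,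
      ¬ MonotoneOn (fun X : Ω → ℝ => lowerQ P α X p) (RVPow P α) ∧
      ¬ AntitoneOn (fun X : Ω → ℝ => lowerQ P α X p) (RVPow P α)) ∧
    -- no subadditivity and no convexity on such a space
    (CarriesUniform P → ∀ α : ℝ, 1 ≤ α → ∀ p ∈ Ioo (0 : ℝ) 1,
      (¬ ∀ X ∈ RVPow P α, ∀ Y ∈ RVPow P α,
        lowerQ P α (fun ω => X ω + Y ω) p ≤ lowerQ P α X p + lowerQ P α Y p) ∧
      (¬ ∀ X ∈ RVPow P α, ∀ Y ∈ RVPow P α, ∀ t ∈ Ioo (0 : ℝ) 1,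
        lowerQ P α (fun ω => (1 - t) * X ω + t * Y ω) p ≤
          (1 - t) * lowerQ P α X p + t * lowerQ P α Y p)) := by

  refine ⟨fun α hα X hX p hp => isGreatest_lowerQ hα hX hp, fun α hα X hX p hp hpp => ?_,
    fun α hα X hX p hp => ?_, fun α hα X hX t ht => ?_, fun α hα X hX t ht => ?_,
    fun α hα X hX t ht => lowerP_lt_real_gt hα hX ht, fun α hα X hX => ⟨?_, ?_⟩,
    fun α hα X hX => ⟨strictAntiOn_lowerQ hα hX, continuousOn_lowerQ hα hX, fun h =>
      ⟨tendsto_lowerQ_pStar hα hX h, tendsto_lowerQ_one hα hX h⟩⟩,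
    fun α β hα hαβ X hX p hp => lowerQ_le_lowerQ hα hαβ hX hp, fun α hα X hX p hp => ?_,
    fun α β hα hαβ X hX p hp => lowerQ_lt_lowerQ hα hαβ hX hp,
    fun X hX p hp => tendsto_lowerQ_atBot hX hp, fun α hα p hp c => lowerQ_const hα hp c,
    fun α hα X hX p hp k hk => lowerQ_mul hα hX hp hk,
    fun α hα X hX p hp c => lowerQ_add hα hX hp c, fun α hα X hX p hp c => ⟨fun h => ?_, fun h => ?_⟩,
    fun hU α hα p hp => ⟨not_monotoneOn_lowerQ hU hα hp, not_antitoneOn_lowerQ hα.le hp⟩,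
    fun hU α hα p hp => ?_⟩
  · have h := lowerQ_of_le_pStar hα hX hp.1 hpp
    exact ⟨h, EReal.coe_eq_coe_iff.1 (h.trans (quantileZero_of_le_pStar hX.1 hp.1 hpp).symm)⟩
  · obtain ⟨h1, h2⟩ := lowerQ_spec hα hX hp
    have h3 := h1.trans_le xStarStar_le_xStar
    exact ⟨⟨_, ⟨h3, h2⟩, fun t ht => (lowerQ_eq_of_lowerP_eq hα hX hp ht.1 ht.2).symm⟩, h3, h2, h1⟩
  · exact ⟨lowerP_eq hα t, lowerP_eq_cond hα hX ht⟩
  · exact ⟨lowerP_le_real_gt hα hX ht, measureReal_mono fun ω hω => (show t < X ω from hω).le,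
      tendsto_lowerP_one hα hX ht⟩
  · exact fun p hp q hq hpq => lowerQ_anti hα hX hp hq hpq
  · exact fun p hp => lowerQ_of_le_pStar hα hX hp.2.1 hp.1.2
  · refine ⟨?_, lowerQ_one (RVPow_anti zero_le_one hα hX) hp⟩
    rcases hα.eq_or_lt with rfl | hα
    · exact le_rfl
    · exact lowerQ_le_lowerQ le_rfl hα hX hp
  · rw [lowerQ_const hα hp]
    exact lowerQ_le_of_ae_le hα hX hp h
  · rw [lowerQ_add hα hX hp]
    linarith
  · obtain ⟨X, hX, Y, hY, hXY, hlt⟩ := exists_lowerQ_add_gt hU hα hp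
    refine ⟨fun h => (h X hX Y hY).not_gt hlt, fun h => ?_⟩
    have h1 := h X hX Y hY (1 / 2) ⟨by norm_num, by norm_num⟩
    -- By homogeneity, convexity at the midpoint is subadditivity for this same pair.
    have h2 : (fun ω => (1 - 1 / 2) * X ω + 1 / 2 * Y ω) = fun ω => 1 / 2 * (X ω + Y ω) := by
      funext ω
      ring
    rw [h2, lowerQ_mul hα hXY hp (by norm_num)] at h1
    linarith
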